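/- For $d\ge 0$ let $V_d$ be the irreducible representation of $\operatorname{SL}_2=\operatorname{SL}_2(\mathbb{C})$ on binary forms of degree $d$. Let $r\ge 1$ and let $V=\bigoplus_{k=1}^r V_{d_k}$ be such that $V^{\operatorname{SL}_2}=\{0\}$. Let $\operatorname{Hilb}_V(t)=\sum_{n\ge 0}\dim\big(\mathbb{C}[V]^{\operatorname{SL}_2}_n\big)\,t^n$ be the Hilbert series of the algebra of invariant polynomial functions on $V$, graded by degree. Put $a_{k,i}:=2i-d_k$, $\Theta:=\{(k,i): 1\le k\le r,\ 0\le i\le d_k\}$, $\Lambda:=\{(k,i)\in\Theta: a_{k,i}>0\}$, let $e$ be the number of even $d_k$, and let $\boldsymbol a:=(a_{k,i})_{(k,i)\in\Lambda}$, $\boldsymbol a_\Theta:=(a_{k,i})_{(k,i)\in\Theta}$. Let $t\in\mathbb{C}$ with $0<|t|<1$, fix any value $\tau$ of the logarithm of $t$, i.e. $e^\tau=t$, and write $t^s:=e^{s\tau}$ for $s\in\mathbb{R}$. Then the series $\operatorname{Hilb}_V(t)$ converges and, for real parameters $\boldsymbol b=(b_{k,i})_{(k,i)\in\Lambda}$,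 $$\operatorname{Hilb}_V(t)=\lim_{\boldsymbol b\to\boldsymbol a}\ \sum_{(K,I)\in\Lambda}\ \sum_{\zeta^{a_{K,I}}=1}\frac{1-\zeta^2t^{2/b_{K,I}}}{b_{K,I}(1-t^2)(1-t)^e\prod_{(k,i)\in\Lambda\smallsetminus\{(K,I)\}}\beta_{K,I,k,i,\zeta}(t)},$$ where $\beta_{K,I,k,i,\zeta}(t):=\big(1-\zeta^{-a_{k,i}}t^{(b_{K,I}-b_{k,i})/b_{K,I}}\big)\big(1-\zeta^{a_{k,i}}t^{(b_{K,I}+b_{k,i})/b_{K,I}}\big)$. Alternatively, for real parameters $\boldsymbol b_\Theta=(b_{k,i})_{(k,i)\in\Theta}$, $$\operatorname{Hilb}_V(t)=\lim_{\boldsymbol b_\Theta\to\boldsymbol a_\Theta}\ \sum_{(K,I)\in\Lambda}\ \sum_{\zeta^{a_{K,I}}=1}\frac{1-\zeta^2t^{2/b_{K,I}}}{b_{K,I}\prod_{(k,i)\in\Theta\smallsetminus\{(K,I)\}}\big(1-\zeta^{-a_{k,i}}t^{(b_{K,I}-b_{k,i})/b_{K,I}}\big)}.$$ Both limits are taken over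 those parameters for which no denominator in the sum vanishes; $\boldsymbol a$, respectively $\boldsymbol a_\Theta$, is a limit of such parameters. Moreover, the singularities coming from repeated weights are removable: for each of the two sums, every integer $m>0$ and every $\zeta\in\mathbb{C}$ with $\zeta^m=1$, near $\boldsymbol a$ (respectively $\boldsymbol a_\Theta$) the parameters for which no denominator in the sum vanishes are dense, and on them the partial sum of the summands with this $\zeta$ over all $(K,I)\in\Lambda$ with $a_{K,I}=m$ agrees with a function that is continuous in a neighbourhood of $\boldsymbol a$ (respectively $\boldsymbol a_\Theta$). -/

import Mathlib

open Filter Topology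
open scoped DirectSum

namespace SL2Hilb

/-! ### Representations of `SL₂(ℂ)` on binary forms -/

/-- The group `SL₂(ℂ)`. -/
abbrev SL2 : Type := Matrix.SpecialLinearGroup (Fin 2) ℂ

/-- The space of binary forms of degree `d` (homogeneous polynomials of degree `d` in `X₀, X₁`). -/
abbrev BinaryForm (d : ℕ) : Type := MvPolynomial.homogeneousSubmodule (Fin 2) ℂ d

/-- The linear substitution `f(X) ↦ f(X g)`, where `X = (X₀, X₁)` is a row vector. -/
noncomputable def subst (g : SL2) :
    MvPolynomial (Fin 2) ℂ →ₐ[ℂ] MvPolynomial (Fin 2) ℂ :=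
  MvPolynomial.aeval fun j => ∑ i, MvPolynomial.C (g i j) * MvPolynomial.X i

theorem subst_mem (g : SL2) {d : ℕ} {f : MvPolynomial (Fin 2) ℂ}
    (hf : f ∈ MvPolynomial.homogeneousSubmodule (Fin 2) ℂ d) :
    subst g f ∈ MvPolynomial.homogeneousSubmodule (Fin 2) ℂ d := by
  rw [MvPolynomial.mem_homogeneousSubmodule] at hf ⊢
  have h := hf.aeval (fun j => ∑ i, MvPolynomial.C (g i j) * MvPolynomial.X i) (n := 1)
    (fun j => MvPolynomial.IsHomogeneous.sum _ _ _
      (fun i _ => MvPolynomial.isHomogeneous_C_mul_X _ _))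
  rwa [one_mul] at h

theorem subst_one : subst 1 = AlgHom.id ℂ _ := by
  apply MvPolynomial.algHom_ext
  intro j
  fin_cases j <;> simp [subst]

theorem subst_mul (g h : SL2) : subst (g * h) = (subst g).comp (subst h) := by
  apply MvPolynomial.algHom_ext
  intro j
  simp only [subst, AlgHom.comp_apply, MvPolynomial.aeval_X, Matrix.SpecialLinearGroup.coe_mul,
    Matrix.mul_apply, Fin.sum_univ_two, map_add, map_mul, MvPolynomial.aeval_C,
    MvPolynomial.algebraMap_eq]
  ring

/-- The irreducible representation `V_d` of `SL₂(ℂ)` on binary forms of degree `d`. -/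
noncomputable def binaryRep (d : ℕ) : Representation ℂ SL2 (BinaryForm d) where
  toFun g := (subst g).toLinearMap.restrict fun _ hf => subst_mem g hf
  map_one' := by
    ext1 f
    apply Subtype.ext
    simp [subst_one]
  map_mul' g h := by
    ext1 f
    apply Subtype.ext
    simp [subst_mul, Module.End.mul_apply]
    rfl

/-- The representation `V = V_{d₁} ⊕ ⋯ ⊕ V_{d_r}`. -/
noncomputable def rep {r : ℕ} (d : Fin r → ℕ) :
    Representation ℂ SL2 (⨁ k : Fin r, BinaryForm (d k)) :=
  Representation.directSum fun k => binaryRep (d k)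

/-! ### Invariant polynomial functions and the Hilbert series -/

section Hilbert

variable {G V : Type*} [Group G] [AddCommMonoid V] [Module ℂ V]

/-- The algebra `ℂ[V]` of polynomial functions on `V`: the algebra of functions generated by the
linear functionals. -/
def polyFun (V : Type*) [AddCommMonoid V] [Module ℂ V] : Subalgebra ℂ (V → ℂ) :=
  Algebra.adjoin ℂ (Set.range fun l : Module.Dual ℂ V => (l : V → ℂ))

/-- The algebra `ℂ[V]^G` of invariant polynomial functions. -/
def invariantRing (ρ : Representation ℂ G V) : Subalgebra ℂ (V → ℂ) where
  carrier := {f | f ∈ polyFun V ∧ ∀ g v, f (ρ g v) = f v}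
  mul_mem' := fun ha hb =>
    ⟨mul_mem ha.1 hb.1, fun g v => by simp [ha.2 g v, hb.2 g v]⟩
  add_mem' := fun ha hb =>
    ⟨add_mem ha.1 hb.1, fun g v => by simp [ha.2 g v, hb.2 g v]⟩
  algebraMap_mem' := fun c => ⟨algebraMap_mem _ c, fun _ _ => rfl⟩

/-- The degree `n` component of `ℂ[V]^G`. -/
def invariantRingDeg (ρ : Representation ℂ G V) (n : ℕ) : Submodule ℂ (V → ℂ) where
  carrier := {f | f ∈ invariantRing ρ ∧ ∀ (c : ℂ) (v : V), f (c • v) = c ^ n * f v}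
  add_mem' := fun ha hb =>
    ⟨add_mem ha.1 hb.1, fun c v => by simp [ha.2 c v, hb.2 c v, mul_add]⟩
  zero_mem' := ⟨zero_mem _, fun _ _ => by simp⟩
  smul_mem' := fun a f hf =>
    ⟨Subalgebra.smul_mem _ hf.1 a, fun c v => by simp [hf.2 c v, mul_left_comm]⟩

/-- The `n`-th term `dim(ℂ[V]^G_n) tⁿ` of the Hilbert series at `t`. -/
noncomputable def hilbTerm (ρ : Representation ℂ G V) (t : ℂ) (n : ℕ) : ℂ :=
  (Module.finrank ℂ (invariantRingDeg ρ n) : ℂ) * t ^ n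

/-- The univariate Hilbert series `∑ₙ dim(ℂ[V]^G_n) tⁿ` at `t`. -/
noncomputable def hilb (ρ : Representation ℂ G V) (t : ℂ) : ℂ :=
  ∑' n, hilbTerm ρ t n

end Hilbert

/-! ### Weights -/

section Weights

variable {r : ℕ}

/-- The index set `Θ` of pairs `(k, i)` with `0 ≤ i ≤ d_k`. -/
abbrev Theta (d : Fin r → ℕ) : Type := Σ k : Fin r, Fin (d k + 1)

/-- The weight `a_{k,i} = 2i - d_k`. -/
def weight (d : Fin r → ℕ) (p : Theta d) : ℤ := 2 * ((p.2 : ℕ) : ℤ) - (d p.1 : ℤ)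

/-- The index set `Λ` of pairs `(k, i) ∈ Θ` with `a_{k,i} > 0`. -/
abbrev Lam (d : Fin r → ℕ) : Type := {p : Theta d // 0 < weight d p}

/-- The number `e` of even `d_k`. -/
def numEven (d : Fin r → ℕ) : ℕ := (Finset.univ.filter fun k => Even (d k)).card

/-- The point `𝐚 = (a_{k,i})` of `ℝ^Λ`. -/
def aLam (d : Fin r → ℕ) : Lam d → ℝ := fun p => (weight d p.1 : ℝ)

/-- The point `𝐚_Θ = (a_{k,i})` of `ℝ^Θ`. -/
def aTheta (d : Fin r → ℕ) : Theta d → ℝ := fun p => (weight d p : ℝ)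

/-- The complex `m`-th roots of unity, for an integer `m > 0`. -/
noncomputable def unityRoots (m : ℤ) : Finset ℂ := Polynomial.nthRootsFinset m.toNat (1 : ℂ)

/-- The real power `t^s = exp(s τ)` formed with the value `τ` of the logarithm of `t = exp τ`. -/
noncomputable def bpow (τ : ℂ) (s : ℝ) : ℂ := Complex.exp ((s : ℂ) * τ)

/-! ### The sum indexed by the positive weights -/

/-- The factor `β_{K,I,k,i,ζ}(t)`, where `P = (K,I)` and `p = (k,i)`. -/
noncomputable def beta (d : Fin r → ℕ) (τ : ℂ) (b : Lam d → ℝ) (P p : Lam d) (ζ : ℂ) : ℂ :=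
  (1 - ζ ^ (-weight d p.1) * bpow τ ((b P - b p) / b P)) *
    (1 - ζ ^ (weight d p.1) * bpow τ ((b P + b p) / b P))

/-- The denominator of the summand for `P = (K,I) ∈ Λ` and `ζ`. -/
noncomputable def denLam (d : Fin r → ℕ) (t τ : ℂ) (b : Lam d → ℝ) (P : Lam d) (ζ : ℂ) : ℂ :=
  (b P : ℂ) * (1 - t ^ 2) * (1 - t) ^ numEven d *
    ∏ p ∈ Finset.univ.erase P, beta d τ b P p ζ

/-- The summand for `P = (K,I) ∈ Λ` and `ζ`. -/
noncomputable def termLam (d : Fin r → ℕ) (t τ : ℂ) (b : Lam d → ℝ) (P : Lam d) (ζ : ℂ) : ℂ :=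
  (1 - ζ ^ 2 * bpow τ (2 / b P)) / denLam d t τ b P ζ

/-- The sum over all `P = (K,I) ∈ Λ` and all `ζ` with `ζ ^ a_{K,I} = 1`. -/
noncomputable def sumLam (d : Fin r → ℕ) (t τ : ℂ) (b : Lam d → ℝ) : ℂ :=
  ∑ P : Lam d, ∑ ζ ∈ unityRoots (weight d P.1), termLam d t τ b P ζ

/-- The natural domain of `sumLam`: the parameters at which no denominator vanishes. -/
def domLam (d : Fin r → ℕ) (t τ : ℂ) : Set (Lam d → ℝ) :=
  {b | ∀ P : Lam d, ∀ ζ ∈ unityRoots (weight d P.1), denLam d t τ b P ζ ≠ 0}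

/-- The partial sum of `sumLam` over the `P = (K,I) ∈ Λ` with `a_{K,I} = m`, for one fixed `ζ`. -/
noncomputable def partLam (d : Fin r → ℕ) (t τ : ℂ) (m : ℤ) (ζ : ℂ) (b : Lam d → ℝ) : ℂ :=
  ∑ P ∈ Finset.univ.filter (fun P : Lam d => weight d P.1 = m), termLam d t τ b P ζ

/-! ### The sum whose factors are indexed by all weights -/

/-- The denominator of the summand for `P = (K,I) ∈ Λ` and `ζ`. -/
noncomputable def denTheta (d : Fin r → ℕ) (τ : ℂ) (b : Theta d → ℝ) (P : Lam d) (ζ : ℂ) : ℂ :=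
  (b P.1 : ℂ) * ∏ p ∈ Finset.univ.erase P.1,
    (1 - ζ ^ (-weight d p) * bpow τ ((b P.1 - b p) / b P.1))

/-- The summand for `P = (K,I) ∈ Λ` and `ζ`. -/
noncomputable def termTheta (d : Fin r → ℕ) (τ : ℂ) (b : Theta d → ℝ) (P : Lam d) (ζ : ℂ) : ℂ :=
  (1 - ζ ^ 2 * bpow τ (2 / b P.1)) / denTheta d τ b P ζ

/-- The sum over all `P = (K,I) ∈ Λ` and all `ζ` with `ζ ^ a_{K,I} = 1`. -/
noncomputable def sumTheta (d : Fin r → ℕ) (τ : ℂ) (b : Theta d → ℝ) : ℂ :=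
  ∑ P : Lam d, ∑ ζ ∈ unityRoots (weight d P.1), termTheta d τ b P ζ

/-- The natural domain of `sumTheta`: the parameters at which no denominator vanishes. -/
def domTheta (d : Fin r → ℕ) (τ : ℂ) : Set (Theta d → ℝ) :=
  {b | ∀ P : Lam d, ∀ ζ ∈ unityRoots (weight d P.1), denTheta d τ b P ζ ≠ 0}

/-- The partial sum of `sumTheta` over the `P = (K,I) ∈ Λ` with `a_{K,I} = m`, for one fixed
`ζ`. -/
noncomputable def partTheta (d : Fin r → ℕ) (τ : ℂ) (m : ℤ) (ζ : ℂ) (b : Theta d → ℝ) : ℂ :=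
  ∑ P ∈ Finset.univ.filter (fun P : Lam d => weight d P.1 = m), termTheta d τ b P ζ

end Weights

/-! ### Limits and removable singularities of partially defined functions -/

/-- `f(b) → l` as `b → a` inside the domain `S` of `f`, where `a` is a limit of points of `S`. -/
def HasLimitOn {ι : Type*} (f : (ι → ℝ) → ℂ) (S : Set (ι → ℝ)) (a : ι → ℝ) (l : ℂ) : Prop :=
  a ∈ closure S ∧ Tendsto f (𝓝[S] a) (𝓝 l)

/-- The singularities near `a` of the function `f` with domain `S` are removable: near `a` the set
`S` is dense, and `f` agrees on `S` with a function that is continuous in a neighbourhood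
of `a`. -/
def HasRemovableSingularities {ι : Type*} (f : (ι → ℝ) → ℂ) (S : Set (ι → ℝ))
    (a : ι → ℝ) : Prop :=
  (∀ᶠ b in 𝓝 a, b ∈ closure S) ∧
    ∃ F : (ι → ℝ) → ℂ, (∀ᶠ b in 𝓝 a, ContinuousAt F b) ∧ ∀ᶠ b in 𝓝 a, b ∈ S → F b = f b

end SL2Hilb

/-! The degree `n` part of `ℂ[V]` is a finite-dimensional `sl₂`-module, and the invariants are its
weight `0` vectors killed by the raising operator. That operator maps weight `0` onto weight `2`, so
the dimension of the invariants is the number of monomials of weight `0` minus the number of weight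
`2` (`finrank_invariantRingDeg`). Extracting these two weights by a contour integral gives `2πi
Hilb(t) = ∮ (1 - z²) z⁻¹ ∏ (1 - z^(-a_p) t)⁻¹ dz` over the unit circle
(`circleIntegral_weylIntegrand`).

The poles in the disc are the points `ζ exp(τ / a_P)` with `a_P > 0` and `ζ ^ a_P = 1`; repeated
weights make them multiple. In the coordinate `z = ζ exp w` the integrand becomes `(1 - ζ² exp(2w))
/ ∏ (1 - ζ^(-a_p) exp(τ - a_p w)) dw`. Here the `a_p` in the exponent can be deformed to real `b_p`,
and the summands of the theorem are the residues at `w = τ / b_P`. For fixed `ζ` and `m` the poles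
with `a_P = m` cluster at `τ / m`. A small fixed circle encloses exactly this cluster, and its
integral is continuous in the parameters even where poles collide. This gives the removable
singularities and the existence of a limit (`exists_continuous_sum_residue`).

To find the limit, note that for `b ≠ a` there is no single-valued integrand on the whole disc. So
`t` is also deformed, to one variable `exp σ_p` for each weight. With `b = a` and generic `σ` the
integrand is rational in `z` with simple poles in the disc, and the ordinary residue theorem applies
(`circleIntegral_residueIntegrand`). The local argument covers both deformations at once, so they
share one limit (`tendsto_sum_residue`).

The sum over `Λ` is the sum over `Θ` at parameters that are odd under `(k, i) ↦ (k, d_k - i)`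
(`oddExt`, `denLam_eq_denTheta`). -/

namespace SL2Hilb

/-! ### A lemma on `sl₂`-triples -/

section Sl2

variable {M : Type*} [AddCommGroup M] [Module ℂ M] (W : ℤ → Submodule ℂ M)
  (R L : Module.End ℂ M)

/-- If `R` raises and `L` lowers weights by `2`, the commutator acts by the weight and the weights
are bounded above, then `R L + c` is injective on spaces of positive weight for `c ≥ 0`. -/
theorem eq_zero_of_raise_lower {B : ℤ} (hR : ∀ μ, ∀ v ∈ W μ, R v ∈ W (μ + 2))
    (hRL : ∀ μ, ∀ v ∈ W μ, R (L v) = L (R v) + (μ : ℂ) • v)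
    (hB : ∀ μ, B < μ → ∀ v ∈ W μ, v = 0) (k : ℕ) :
    ∀ μ : ℤ, 0 < μ → B < μ + k → ∀ c : ℤ, 0 ≤ c → ∀ v ∈ W μ,
      R (L v) + (c : ℂ) • v = 0 → v = 0 := by
  induction k with
  | zero => exact fun μ _ h c _ v hv _ => hB μ (by simpa using h) v hv
  | succ k ih =>
    intro μ hμ h c hc v hv hv0
    -- Applying `R` to the equation gives the same equation for `R v`, with `(μ, c)` replaced by `(μ
    -- + 2, c + μ)`; this is why a constant `c` is carried along.
    have h1 : R v = 0 := by
      refine ih (μ + 2) (by omega) (by push_cast at h; omega) (c + μ) (by omega) _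
        (hR μ v hv) ?_
      have h2 := congrArg R hv0
      rw [hRL μ v hv] at h2
      simp only [map_add, map_smul, map_zero] at h2
      rw [← h2]
      push_cast
      module
    rw [hRL μ v hv, h1, map_zero, zero_add, ← add_smul] at hv0
    refine (smul_eq_zero.mp hv0).resolve_left ?_
    exact_mod_cast (by omega : μ + c ≠ 0)

/-- `R L` is injective on the finite-dimensional space of weight `2`, hence bijective there, so `R`
maps weight `0` onto weight `2`. Rank-nullity does the rest. -/
theorem finrank_ker_raise {B : ℤ} [∀ μ, FiniteDimensional ℂ (W μ)]
    (hR : ∀ μ, ∀ v ∈ W μ, R v ∈ W (μ + 2)) (hL : ∀ μ, ∀ v ∈ W μ, L v ∈ W (μ - 2))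
    (hRL : ∀ μ, ∀ v ∈ W μ, R (L v) = L (R v) + (μ : ℂ) • v)
    (hB : ∀ μ, B < μ → ∀ v ∈ W μ, v = 0) :
    Module.finrank ℂ (W 0 ⊓ LinearMap.ker R : Submodule ℂ M) + Module.finrank ℂ (W 2) =
      Module.finrank ℂ (W 0) := by
  let f : W 0 →ₗ[ℂ] W 2 := R.restrict fun v hv => by simpa using hR 0 v hv
  let g : W 2 →ₗ[ℂ] W 0 := L.restrict fun v hv => by simpa using hL 2 v hv
  have hinj : Function.Injective (f ∘ₗ g) := by
    rw [injective_iff_map_eq_zero]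
    intro v hv
    apply Subtype.ext
    refine eq_zero_of_raise_lower W R L hR hRL hB (B + 1).toNat 2 (by norm_num)
      (by have := Int.self_le_toNat (B + 1); omega) 0 le_rfl v v.2 ?_
    rw [Int.cast_zero, zero_smul, add_zero]
    exact congrArg Subtype.val hv
  have hsurj : Function.Surjective f :=
    Function.Surjective.of_comp (LinearMap.injective_iff_surjective.mp hinj)
  have h1 := f.finrank_range_add_finrank_ker
  rw [LinearMap.range_eq_top.mpr hsurj, finrank_top] at h1
  have h2 : (LinearMap.ker f).map (W 0).subtype = W 0 ⊓ LinearMap.ker R := by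
    ext v
    simp only [Submodule.mem_map, LinearMap.mem_ker, Submodule.mem_inf]
    constructor
    · rintro ⟨x, hx, rfl⟩
      exact ⟨x.2, congrArg Subtype.val hx⟩
    · rintro ⟨hv, hv0⟩
      exact ⟨⟨v, hv⟩, Subtype.ext hv0, rfl⟩
  rw [← h2, ← h1, add_comm,
    (Submodule.equivMapOfInjective (W 0).subtype (W 0).injective_subtype _).finrank_eq]

/-- Reversing the grading exchanges `R` and `L`. Then `L v` has weight `2`, and `R (L v) = L (R v) =
0` at weight `0`, so the injectivity statement kills `L v`. -/
theorem lower_eq_zero_of_raise_eq_zero {B : ℤ}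
    (hL : ∀ μ, ∀ v ∈ W μ, L v ∈ W (μ - 2))
    (hRL : ∀ μ, ∀ v ∈ W μ, R (L v) = L (R v) + (μ : ℂ) • v)
    (hB : ∀ μ, μ < B → ∀ v ∈ W μ, v = 0) {v : M} (hv : v ∈ W 0) (h : R v = 0) : L v = 0 := by
  refine eq_zero_of_raise_lower (B := -B) (fun μ => W (-μ)) L R (fun μ w hw => ?_)
    (fun μ w hw => ?_) (fun μ hμ w hw => hB (-μ) (by omega) w hw) (-B + 1).toNat 2 (by norm_num)
      (by have := Int.self_le_toNat (-B + 1); omega) 0 le_rfl (L v) (hL 0 v hv) ?_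
  · have := hL _ w hw
    rwa [show -μ - 2 = -(μ + 2) by ring] at this
  · rw [hRL _ w hw]
    push_cast
    module
  · rw [hRL 0 v hv, h]
    simp

end Sl2

/-! ### Derivations of the polynomial ring in the coordinates -/

section Diagonal

open MvPolynomial

variable {σ : Type*} [Fintype σ]

/-- The derivation `∑ c_p x_p ∂/∂x_p`. -/
noncomputable def diagDer (c : σ → ℂ) : Derivation ℂ (MvPolynomial σ ℂ) (MvPolynomial σ ℂ) :=
  mkDerivation ℂ fun p => c p • X p

theorem coeff_diagDer (c : σ → ℂ) (α : σ →₀ ℕ) (P : MvPolynomial σ ℂ) :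
    coeff α (diagDer c P) = (∑ p, (α p : ℂ) * c p) * coeff α P := by
  classical
  induction P using MvPolynomial.induction_on' with
  | add p q hp hq => simp [hp, hq, mul_add]
  | monomial s a =>
    have h1 : ∀ p, s p ≠ 0 → (monomial (s - Finsupp.single p 1) (s p : ℂ)) • (c p • X p) =
        (monomial s ((s p : ℂ) * c p) : MvPolynomial σ ℂ) := by
      intro p hp
      rw [smul_eq_mul, mul_smul_comm, X, monomial_mul, mul_one, smul_monomial,
        tsub_add_cancel_of_le, smul_eq_mul, mul_comm]
      exact Finsupp.single_le_iff.mpr (Nat.one_le_iff_ne_zero.mpr hp)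
    have h2 : (s.sum fun i k => (monomial (s - Finsupp.single i 1) (k : ℂ)) • (c i • X i)) =
        (monomial s (∑ p, (s p : ℂ) * c p) : MvPolynomial σ ℂ) := by
      rw [Finsupp.sum, Finset.sum_congr rfl (fun p hp => h1 p (Finsupp.mem_support_iff.mp hp)),
        ← map_sum (monomial s), Finset.sum_subset (Finset.subset_univ _)]
      intro p _ hp
      simp [Finsupp.notMem_support_iff.mp hp]
    rw [diagDer, mkDerivation_monomial, h2, smul_monomial, coeff_monomial, coeff_monomial]
    split_ifs with h
    · subst h
      simp [mul_comm]
    · simp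

theorem diagDer_eq_smul_iff (c : σ → ℂ) (μ : ℂ) (P : MvPolynomial σ ℂ) :
    diagDer c P = μ • P ↔ ∀ α ∈ P.support, ∑ p, (α p : ℂ) * c p = μ := by
  rw [MvPolynomial.ext_iff]
  refine forall_congr' fun α => ?_
  rw [coeff_diagDer, coeff_smul, smul_eq_mul, mem_support_iff]
  constructor
  · exact fun h h0 => mul_right_cancel₀ h0 h
  · intro h
    by_cases h0 : coeff α P = 0
    · simp [h0]
    · rw [h h0]

end Diagonal

/-! ### The `sl₂`-triple of derivations and its weight spaces -/

section Weight

open MvPolynomial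

variable {r : ℕ} (d : Fin r → ℕ)

/-- The exponents of the monomials of degree `n` and weight `μ`. -/
def wset (n : ℕ) (μ : ℤ) : Finset (Theta d →₀ ℕ) :=
  {α ∈ Finset.univ.finsuppAntidiag n | ∑ p, (α p : ℤ) * weight d p = μ}

/-- The polynomials of degree `n` and weight `μ`. -/
noncomputable def wspace (n : ℕ) (μ : ℤ) : Submodule ℂ (MvPolynomial (Theta d) ℂ) :=
  restrictSupport ℂ (wset d n μ : Set (Theta d →₀ ℕ))

theorem mem_wset {n : ℕ} {μ : ℤ} {α : Theta d →₀ ℕ} :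
    α ∈ wset d n μ ↔ ∑ p, α p = n ∧ ∑ p, (α p : ℤ) * weight d p = μ := by
  simp [wset, Finset.mem_finsuppAntidiag]

/-- The Euler derivation. -/
noncomputable abbrev euler (σ : Type*) : Derivation ℂ (MvPolynomial σ ℂ) (MvPolynomial σ ℂ) :=
  diagDer fun _ => 1

/-- The derivation acting on weight vectors by the weight. -/
noncomputable abbrev wtDer :
    Derivation ℂ (MvPolynomial (Theta d) ℂ) (MvPolynomial (Theta d) ℂ) :=
  diagDer fun p => (weight d p : ℂ)

/-- Both derivations are diagonal on monomials. With this description, commutators alone show how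
`raise` and `lower` move degree and weight. -/
theorem mem_wspace {n : ℕ} {μ : ℤ} {P : MvPolynomial (Theta d) ℂ} :
    P ∈ wspace d n μ ↔ euler _ P = (n : ℂ) • P ∧ wtDer d P = (μ : ℂ) • P := by
  rw [diagDer_eq_smul_iff, diagDer_eq_smul_iff, ← forall₂_and, wspace, mem_restrictSupport_iff]
  refine forall₂_congr fun α _ => ?_
  rw [Finset.mem_coe, mem_wset]
  refine and_congr ?_ ?_
  · rw [← @Nat.cast_inj ℂ]
    simp
  · rw [← @Int.cast_inj ℂ]
    simp

instance (n : ℕ) (μ : ℤ) : FiniteDimensional ℂ (wspace d n μ) :=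
  Module.Finite.of_basis (basisRestrictSupport ℂ (wset d n μ : Set (Theta d →₀ ℕ)))

theorem finrank_wspace (n : ℕ) (μ : ℤ) :
    Module.finrank ℂ (wspace d n μ) = (wset d n μ).card := by
  rw [wspace, Module.finrank_eq_nat_card_basis
    (basisRestrictSupport ℂ (wset d n μ : Set (Theta d →₀ ℕ)))]
  simp

/-- The coordinate `x_{k,j}`, which is zero if `j > d_k`. -/
noncomputable def xvar (k : Fin r) (j : ℕ) : MvPolynomial (Theta d) ℂ :=
  if h : j < d k + 1 then X ⟨k, ⟨j, h⟩⟩ else 0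

theorem X_eq_xvar (p : Theta d) : (X p : MvPolynomial (Theta d) ℂ) = xvar d p.1 p.2 := by
  rw [xvar, dif_pos p.2.2]

theorem derivation_eq_of_xvar {D₁ D₂ : Derivation ℂ (MvPolynomial (Theta d) ℂ)
    (MvPolynomial (Theta d) ℂ)} (h : ∀ k, ∀ j ≤ d k, D₁ (xvar d k j) = D₂ (xvar d k j)) :
    D₁ = D₂ := by
  refine derivation_ext fun p => ?_
  rw [X_eq_xvar]
  exact h _ _ (Nat.lt_succ_iff.mp p.2.2)

/-- The derivation `∑ (j+1) x_{k,j+1} ∂/∂x_{k,j}`. -/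
noncomputable def raise :
    Derivation ℂ (MvPolynomial (Theta d) ℂ) (MvPolynomial (Theta d) ℂ) :=
  mkDerivation ℂ fun p => ((p.2 : ℕ) + 1 : ℂ) • xvar d p.1 (p.2 + 1)

/-- The derivation `∑ (d_k-j) x_{k,j} ∂/∂x_{k,j+1}`. -/
noncomputable def lower :
    Derivation ℂ (MvPolynomial (Theta d) ℂ) (MvPolynomial (Theta d) ℂ) :=
  -- The case `j = 0` is separate because `p.2 - 1` truncates to `0`; the coefficient is `d_k - (j -
  -- 1)`.
  mkDerivation ℂ fun p => if (p.2 : ℕ) = 0 then 0 else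
    ((d p.1 : ℂ) + 1 - (p.2 : ℕ)) • xvar d p.1 (p.2 - 1)

theorem raise_xvar (k : Fin r) (j : ℕ) :
    raise d (xvar d k j) = ((j : ℂ) + 1) • xvar d k (j + 1) := by
  by_cases h : j < d k + 1
  · rw [xvar, dif_pos h, raise, mkDerivation_X]
  · rw [xvar, dif_neg h, xvar, dif_neg (by omega), map_zero, smul_zero]

theorem lower_xvar_zero (k : Fin r) : lower d (xvar d k 0) = 0 := by
  rw [xvar, dif_pos (by omega), lower, mkDerivation_X]
  simp

/-- No bound on `j` is needed: at `j = d_k` the coefficient vanishes, and beyond that both variables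
are zero. -/
theorem lower_xvar_succ (k : Fin r) (j : ℕ) :
    lower d (xvar d k (j + 1)) = ((d k : ℂ) - j) • xvar d k j := by
  by_cases h : j + 1 < d k + 1
  · rw [xvar, dif_pos h, lower, mkDerivation_X]
    simp
  · rw [xvar, dif_neg h, map_zero]
    rcases eq_or_ne j (d k) with rfl | h'
    · simp
    · rw [xvar, dif_neg (by omega), smul_zero]

theorem diagDer_xvar (c : Theta d → ℂ) (k : Fin r) (j : ℕ) (a : ℂ)
    (h : ∀ hj : j < d k + 1, c ⟨k, ⟨j, hj⟩⟩ = a) : diagDer c (xvar d k j) = a • xvar d k j := by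
  by_cases hj : j < d k + 1
  · rw [xvar, dif_pos hj, diagDer, mkDerivation_X, h hj]
  · rw [xvar, dif_neg hj, map_zero, smul_zero]

theorem euler_xvar (k : Fin r) (j : ℕ) : euler _ (xvar d k j) = xvar d k j := by
  rw [diagDer_xvar d _ k j 1 (fun _ => rfl), one_smul]

theorem wtDer_xvar (k : Fin r) (j : ℕ) :
    wtDer d (xvar d k j) = (2 * (j : ℂ) - d k) • xvar d k j :=
  diagDer_xvar d _ k j _ fun _ => by simp [weight]

theorem commutator_raise_lower : ⁅raise d, lower d⁆ = wtDer d := by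
  refine derivation_eq_of_xvar d fun k j _ => ?_
  rw [Derivation.commutator_apply, wtDer_xvar]
  cases j with
  | zero =>
    rw [lower_xvar_zero, raise_xvar, Derivation.map_smul, lower_xvar_succ, map_zero]
    simp
  | succ j =>
    rw [lower_xvar_succ, raise_xvar, Derivation.map_smul, Derivation.map_smul, raise_xvar, lower_xvar_succ]
    push_cast
    module

theorem commutator_wtDer_raise : ⁅wtDer d, raise d⁆ = (2 : ℂ) • raise d := by
  refine derivation_eq_of_xvar d fun k j _ => ?_
  rw [Derivation.commutator_apply, wtDer_xvar, Derivation.map_smul, Derivation.smul_apply, raise_xvar,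
    Derivation.map_smul, wtDer_xvar]
  push_cast
  module

theorem commutator_wtDer_lower : ⁅wtDer d, lower d⁆ = (-2 : ℂ) • lower d := by
  refine derivation_eq_of_xvar d fun k j _ => ?_
  rw [Derivation.commutator_apply, wtDer_xvar, Derivation.map_smul, Derivation.smul_apply]
  cases j with
  | zero => simp [lower_xvar_zero]
  | succ j =>
    rw [lower_xvar_succ, Derivation.map_smul, wtDer_xvar]
    push_cast
    module

theorem commutator_euler_raise : ⁅euler (Theta d), raise d⁆ = 0 := by
  refine derivation_eq_of_xvar d fun k j _ => ?_
  rw [Derivation.commutator_apply, euler_xvar, raise_xvar, Derivation.map_smul, euler_xvar, sub_self]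
  rfl

theorem commutator_euler_lower : ⁅euler (Theta d), lower d⁆ = 0 := by
  refine derivation_eq_of_xvar d fun k j _ => ?_
  rw [Derivation.commutator_apply, euler_xvar]
  cases j with
  | zero => simp [lower_xvar_zero]
  | succ j =>
    rw [lower_xvar_succ, Derivation.map_smul, euler_xvar, sub_self]
    rfl

variable {d}

theorem raise_mem_wspace {n : ℕ} {μ : ℤ} {P : MvPolynomial (Theta d) ℂ}
    (hP : P ∈ wspace d n μ) : raise d P ∈ wspace d n (μ + 2) := by
  rw [mem_wspace] at hP ⊢
  have h1 := DFunLike.congr_fun (commutator_euler_raise d) P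
  have h2 := DFunLike.congr_fun (commutator_wtDer_raise d) P
  rw [Derivation.commutator_apply, hP.1, Derivation.map_smul, sub_eq_iff_eq_add] at h1
  rw [Derivation.commutator_apply, hP.2, Derivation.map_smul, sub_eq_iff_eq_add] at h2
  refine ⟨by rw [h1]; simp, ?_⟩
  rw [h2, Derivation.smul_apply]
  push_cast
  module

theorem lower_mem_wspace {n : ℕ} {μ : ℤ} {P : MvPolynomial (Theta d) ℂ}
    (hP : P ∈ wspace d n μ) : lower d P ∈ wspace d n (μ - 2) := by
  rw [mem_wspace] at hP ⊢
  have h1 := DFunLike.congr_fun (commutator_euler_lower d) P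
  have h2 := DFunLike.congr_fun (commutator_wtDer_lower d) P
  rw [Derivation.commutator_apply, hP.1, Derivation.map_smul, sub_eq_iff_eq_add] at h1
  rw [Derivation.commutator_apply, hP.2, Derivation.map_smul, sub_eq_iff_eq_add] at h2
  refine ⟨by rw [h1]; simp, ?_⟩
  rw [h2, Derivation.smul_apply]
  push_cast
  module

theorem raise_lower_of_mem_wspace {n : ℕ} {μ : ℤ} {P : MvPolynomial (Theta d) ℂ}
    (hP : P ∈ wspace d n μ) : raise d (lower d P) = lower d (raise d P) + (μ : ℂ) • P := by
  have h := DFunLike.congr_fun (commutator_raise_lower d) P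
  rw [Derivation.commutator_apply, ((mem_wspace d).mp hP).2, sub_eq_iff_eq_add] at h
  rw [h, add_comm]

/-- In a fixed degree only finitely many weights occur; this supplies the bound `B` of the `sl₂`
lemmas. -/
theorem abs_le_of_mem_wset {n : ℕ} {μ : ℤ} {α : Theta d →₀ ℕ} (hα : α ∈ wset d n μ) :
    |μ| ≤ n * ∑ p, |weight d p| := by
  obtain ⟨h1, h2⟩ := (mem_wset d).mp hα
  rw [← h2, ← h1, Nat.cast_sum, Finset.sum_mul]
  refine (Finset.abs_sum_le_sum_abs _ _).trans (Finset.sum_le_sum fun p _ => ?_)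
  rw [abs_mul, Nat.abs_cast]
  exact mul_le_mul_of_nonneg_left
    (Finset.single_le_sum (f := fun p => |weight d p|) (fun _ _ => abs_nonneg _)
      (Finset.mem_univ p)) (by positivity)

theorem eq_zero_of_mem_wspace {n : ℕ} {μ : ℤ} (hμ : n * ∑ p, |weight d p| < |μ|)
    {P : MvPolynomial (Theta d) ℂ} (hP : P ∈ wspace d n μ) : P = 0 := by
  rw [← support_eq_empty, Finset.eq_empty_iff_forall_notMem]
  exact fun α hα => hμ.not_ge (abs_le_of_mem_wset
    (Finset.mem_coe.mp ((mem_restrictSupport_iff ℂ).mp hP hα)))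

variable (d)

theorem finrank_ker_raise_wspace (n : ℕ) :
    Module.finrank ℂ (wspace d n 0 ⊓ LinearMap.ker (raise d).toLinearMap :
      Submodule ℂ (MvPolynomial (Theta d) ℂ)) + (wset d n 2).card = (wset d n 0).card := by
  rw [← finrank_wspace, ← finrank_wspace]
  exact finrank_ker_raise (B := n * ∑ p, |weight d p|) (wspace d n) (raise d).toLinearMap
    (lower d).toLinearMap (fun _ _ h => raise_mem_wspace h) (fun _ _ h => lower_mem_wspace h)
    (fun _ _ h => raise_lower_of_mem_wspace h)
    (fun μ hμ _ h => eq_zero_of_mem_wspace (lt_of_lt_of_le hμ (le_abs_self _)) h)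

/-- A weight `0` vector killed by `raise` is killed by `lower` too; conversely the commutator of the
two is the weight, which must then be `0`. -/
theorem mem_inf_ker_raise_iff (n : ℕ) (P : MvPolynomial (Theta d) ℂ) :
    P ∈ (wspace d n 0 ⊓ LinearMap.ker (raise d).toLinearMap :
      Submodule ℂ (MvPolynomial (Theta d) ℂ)) ↔
      euler _ P = (n : ℂ) • P ∧ raise d P = 0 ∧ lower d P = 0 := by
  constructor
  · rintro ⟨h1, h2⟩
    refine ⟨((mem_wspace d).mp h1).1, h2, ?_⟩
    refine lower_eq_zero_of_raise_eq_zero (B := -(n * ∑ p, |weight d p|)) (wspace d n)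
      (raise d).toLinearMap (lower d).toLinearMap (fun _ _ h => lower_mem_wspace h)
      (fun _ _ h => raise_lower_of_mem_wspace h)
      (fun μ hμ _ h => eq_zero_of_mem_wspace ?_ h) h1 h2
    rw [lt_neg] at hμ
    exact lt_of_lt_of_le hμ (neg_le_abs _)
  · rintro ⟨h1, h2, h3⟩
    refine ⟨(mem_wspace d).mpr ⟨h1, ?_⟩, h2⟩
    rw [← commutator_raise_lower, Derivation.commutator_apply, h2, h3]
    simp

end Weight

/-! ### Invariants as polynomials killed by the raising and lowering operators -/

section OneParameter

open MvPolynomial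

/-- If `x` moves along the vector field `D`, then polynomials change along it by `D`. Both sides
obey the Leibniz rule, so the variables suffice. -/
theorem hasDerivAt_eval {σ : Type*} (D : Derivation ℂ (MvPolynomial σ ℂ) (MvPolynomial σ ℂ))
    {x : ℂ → σ → ℂ} {s : ℂ}
    (hx : ∀ p, HasDerivAt (fun s => x s p) (eval (x s) (D (X p))) s) (P : MvPolynomial σ ℂ) :
    HasDerivAt (fun s => eval (x s) P) (eval (x s) (D P)) s := by
  induction P using MvPolynomial.induction_on with
  | C a => simpa using hasDerivAt_const s a
  | add p q hp hq => simpa using hp.fun_add hq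
  | mul_X p i hp =>
    have h := hp.fun_mul (hx i)
    rw [Derivation.leibniz]
    simp only [smul_eq_mul, map_add, map_mul, eval_X]
    exact h.congr_deriv (by ring)

theorem hasDerivAt_coeff_subst {u : ℂ → SL2}
    (D : Derivation ℂ (MvPolynomial (Fin 2) ℂ) (MvPolynomial (Fin 2) ℂ)) {s : ℂ}
    (hX : ∀ i m, HasDerivAt (fun s => coeff m (subst (u s) (X i)))
      (coeff m (D (subst (u s) (X i)))) s) (f : MvPolynomial (Fin 2) ℂ) (m : Fin 2 →₀ ℕ) :
    HasDerivAt (fun s => coeff m (subst (u s) f)) (coeff m (D (subst (u s) f))) s := by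
  induction f using MvPolynomial.induction_on generalizing m with
  | C a =>
    have h : ∀ s, subst (u s) (C a) = C a := fun s => (subst (u s)).commutes a
    simp only [h, derivation_C, coeff_zero]
    exact hasDerivAt_const s _
  | add p q hp hq => simpa using (hp m).fun_add (hq m)
  | mul_X p i hp =>
    simp only [map_mul, Derivation.leibniz, smul_eq_mul, coeff_add]
    rw [mul_comm (subst (u s) (X i)), coeff_mul, coeff_mul, ← Finset.sum_add_distrib]
    simp only [coeff_mul]
    refine HasDerivAt.fun_sum fun y _ => ?_
    rw [add_comm]
    exact (hp y.1).mul (hX i y.2)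

/-- The one-parameter subgroup of upper unipotent matrices. -/
def upperUni (s : ℂ) : SL2 := ⟨!![1, s; 0, 1], by simp⟩

/-- The one-parameter subgroup of lower unipotent matrices. -/
def lowerUni (s : ℂ) : SL2 := ⟨!![1, 0; s, 1], by simp⟩

theorem upperUni_zero : upperUni 0 = 1 := by
  ext i j
  fin_cases i <;> fin_cases j <;> rfl

theorem lowerUni_zero : lowerUni 0 = 1 := by
  ext i j
  fin_cases i <;> fin_cases j <;> rfl

theorem exists_eq_uni_of_ne_zero {g : SL2} (h : g 1 0 ≠ 0) :
    ∃ s t u, g = upperUni s * lowerUni t * upperUni u := by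
  -- The product has lower left entry `t` and diagonal `1 + s t`, `1 + t u`; these determine `s`,
  -- `t`, `u`, and the determinant settles the last entry.
  refine ⟨(g 0 0 - 1) / g 1 0, g 1 0, (g 1 1 - 1) / g 1 0, ?_⟩
  have hdet := Matrix.det_fin_two g.1
  rw [g.2] at hdet
  ext i j
  fin_cases i <;> fin_cases j <;>
    simp only [Matrix.SpecialLinearGroup.coe_mul, Matrix.mul_apply, Fin.sum_univ_two] <;>
    simp [upperUni, lowerUni] <;> field_simp
  · ring
  · linear_combination hdet
  · ring

theorem closure_uni : Subgroup.closure (Set.range upperUni ∪ Set.range lowerUni) = ⊤ := by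
  rw [eq_top_iff]
  have hU : ∀ s, upperUni s ∈ Subgroup.closure (Set.range upperUni ∪ Set.range lowerUni) :=
    fun s => Subgroup.subset_closure (Or.inl ⟨s, rfl⟩)
  have hL : ∀ s, lowerUni s ∈ Subgroup.closure (Set.range upperUni ∪ Set.range lowerUni) :=
    fun s => Subgroup.subset_closure (Or.inr ⟨s, rfl⟩)
  have key : ∀ g : SL2, g 1 0 ≠ 0 →
      g ∈ Subgroup.closure (Set.range upperUni ∪ Set.range lowerUni) := by
    intro g hg
    obtain ⟨s, t, u, rfl⟩ := exists_eq_uni_of_ne_zero hg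
    exact mul_mem (mul_mem (hU s) (hL t)) (hU u)
  intro g _
  by_cases h : g 1 0 = 0
  -- Multiplying by `lowerUni 1` turns the lower left entry `0` into `g 1 1`, which is nonzero since
  -- the determinant is `1`.
  · rw [← Subgroup.mul_mem_cancel_right _ (hL 1)]
    refine key _ ?_
    have hdet := Matrix.det_fin_two g.1
    rw [g.2] at hdet
    intro h'
    simp only [Matrix.SpecialLinearGroup.coe_mul, Matrix.mul_apply, Fin.sum_univ_two] at h'
    simp [lowerUni, h] at h'
    simp [h, h'] at hdet
  · exact key g h

/-- The derivation `X₀ ∂/∂X₁`. -/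
noncomputable def derE : Derivation ℂ (MvPolynomial (Fin 2) ℂ) (MvPolynomial (Fin 2) ℂ) :=
  (X 0 : MvPolynomial (Fin 2) ℂ) • pderiv 1

/-- The derivation `X₁ ∂/∂X₀`. -/
noncomputable def derF : Derivation ℂ (MvPolynomial (Fin 2) ℂ) (MvPolynomial (Fin 2) ℂ) :=
  (X 1 : MvPolynomial (Fin 2) ℂ) • pderiv 0

theorem hasDerivAt_coeff_upperUni (f : MvPolynomial (Fin 2) ℂ) (m : Fin 2 →₀ ℕ) (s : ℂ) :
    HasDerivAt (fun s => coeff m (subst (upperUni s) f))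
      (coeff m (derE (subst (upperUni s) f))) s := by
  refine hasDerivAt_coeff_subst derE (fun i m => ?_) f m
  fin_cases i
  · simp [subst, upperUni, derE, Derivation.smul_apply, pderiv_X, hasDerivAt_const]
  · simpa [subst, upperUni, derE, Derivation.smul_apply, pderiv_X] using
      ((hasDerivAt_id s).mul_const (coeff m (X 0 : MvPolynomial (Fin 2) ℂ))).add_const
        (coeff m (X 1))

theorem hasDerivAt_coeff_lowerUni (f : MvPolynomial (Fin 2) ℂ) (m : Fin 2 →₀ ℕ) (s : ℂ) :
    HasDerivAt (fun s => coeff m (subst (lowerUni s) f))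
      (coeff m (derF (subst (lowerUni s) f))) s := by
  refine hasDerivAt_coeff_subst derF (fun i m => ?_) f m
  fin_cases i
  · simpa [subst, lowerUni, derF, Derivation.smul_apply, pderiv_X] using
      ((hasDerivAt_id s).mul_const (coeff m (X 1 : MvPolynomial (Fin 2) ℂ))).const_add
        (coeff m (X 0))
  · simp [subst, lowerUni, derF, Derivation.smul_apply, pderiv_X, hasDerivAt_const]

end OneParameter

/-! ### Coordinates on `V` and the infinitesimal form of invariance -/

section Coordinates

open MvPolynomial

variable {r : ℕ} (d : Fin r → ℕ)

/-- The exponent of `X₀^i X₁^j`. -/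
noncomputable def expo (i j : ℕ) : Fin 2 →₀ ℕ := Finsupp.single 0 i + Finsupp.single 1 j

theorem expo_zero (i j : ℕ) : expo i j 0 = i := by simp [expo]

theorem expo_one (i j : ℕ) : expo i j 1 = j := by simp [expo]

theorem eq_expo (m : Fin 2 →₀ ℕ) : m = expo (m 0) (m 1) := by
  ext i
  fin_cases i
  · exact (expo_zero _ _).symm
  · exact (expo_one _ _).symm

theorem expo_inj {i j i' j' : ℕ} : expo i j = expo i' j' ↔ i = i' ∧ j = j' := by
  constructor
  · intro h
    have h0 := DFunLike.congr_fun h 0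
    have h1 := DFunLike.congr_fun h 1
    rw [expo_zero, expo_zero] at h0
    rw [expo_one, expo_one] at h1
    exact ⟨h0, h1⟩
  · rintro ⟨rfl, rfl⟩
    rfl

theorem coeff_derE_zero (f : MvPolynomial (Fin 2) ℂ) (j : ℕ) : coeff (expo 0 j) (derE f) = 0 := by
  rw [derE, Derivation.smul_apply, smul_eq_mul, coeff_X_mul', if_neg]
  simp [expo_zero]

theorem coeff_derE_succ (f : MvPolynomial (Fin 2) ℂ) (i j : ℕ) :
    coeff (expo (i + 1) j) (derE f) = (j + 1) * coeff (expo i (j + 1)) f := by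
  have h : expo (i + 1) j = Finsupp.single 0 1 + expo i j := by
    rw [expo, expo, ← add_assoc, ← Finsupp.single_add, add_comm 1]
  rw [derE, Derivation.smul_apply, smul_eq_mul, h, coeff_X_mul, coeff_pderiv, expo_one, mul_comm,
    expo, expo, add_assoc, ← Finsupp.single_add]

theorem coeff_derF_zero (f : MvPolynomial (Fin 2) ℂ) (i : ℕ) : coeff (expo i 0) (derF f) = 0 := by
  rw [derF, Derivation.smul_apply, smul_eq_mul, coeff_X_mul', if_neg]
  simp [expo_one]

theorem coeff_derF_succ (f : MvPolynomial (Fin 2) ℂ) (i j : ℕ) :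
    coeff (expo i (j + 1)) (derF f) = (i + 1) * coeff (expo (i + 1) j) f := by
  have h : expo i (j + 1) = Finsupp.single 1 1 + expo i j := by
    rw [expo, expo, add_left_comm, ← Finsupp.single_add, add_comm 1]
  have h' : expo i j + Finsupp.single 0 1 = expo (i + 1) j := by
    rw [expo, expo, add_right_comm, ← Finsupp.single_add]
  rw [derF, Derivation.smul_apply, smul_eq_mul, h, coeff_X_mul, coeff_pderiv, expo_zero, mul_comm,
    h']

/-- The coordinates of `v ∈ V` in the basis of monomials `X₀^i X₁^(d_k-i)`. -/
noncomputable def coord : (⨁ k : Fin r, BinaryForm (d k)) →ₗ[ℂ] (Theta d → ℂ) where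
  toFun v p := coeff (expo p.2 (d p.1 - p.2)) (v p.1).1
  map_add' v w := by
    ext p
    simp
  map_smul' c v := by
    ext p
    simp [DirectSum.smul_apply]

theorem coord_apply (v : ⨁ k : Fin r, BinaryForm (d k)) (p : Theta d) :
    coord d v p = coeff (expo p.2 (d p.1 - p.2)) (v p.1).1 := rfl

theorem coord_rep (g : SL2) (v : ⨁ k : Fin r, BinaryForm (d k)) (p : Theta d) :
    coord d (rep d g v) p = coeff (expo p.2 (d p.1 - p.2)) (subst g (v p.1).1) := rfl

theorem isHomogeneous_monomial_expo {n : ℕ} (i : Fin (n + 1)) :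
    (monomial (expo i (n - i)) (1 : ℂ)) ∈ homogeneousSubmodule (Fin 2) ℂ n := by
  refine (mem_homogeneousSubmodule _ _).mpr (isHomogeneous_monomial _ ?_)
  rw [expo, map_add, Finsupp.degree_single, Finsupp.degree_single]
  have := i.2
  omega

theorem coord_injective : Function.Injective (coord d) := by
  rw [injective_iff_map_eq_zero]
  intro v hv
  refine DFinsupp.ext fun k => Subtype.ext ?_
  ext m
  simp only [DirectSum.zero_apply, Submodule.coe_zero, coeff_zero]
  by_contra h
  have h1 := (mem_homogeneousSubmodule _ _).mp (v k).2 h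
  rw [Finsupp.weight_apply, Finsupp.sum_fintype _ _ (by simp)] at h1
  simp [Fin.sum_univ_two] at h1
  have h2 := congrFun hv ⟨k, ⟨m 0, by omega⟩⟩
  rw [coord_apply] at h2
  rw [eq_expo m] at h
  refine h ?_
  rw [show m 1 = d k - m 0 by omega]
  exact h2

theorem coord_surjective : Function.Surjective (coord d) := by
  intro x
  refine ⟨(DirectSum.linearEquivFunOnFintype ℂ (Fin r) fun k => BinaryForm (d k)).symm
    fun k => ∑ i : Fin (d k + 1), x ⟨k, i⟩ • ⟨_, isHomogeneous_monomial_expo i⟩, ?_⟩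
  ext p
  rw [coord_apply]
  have h : ∀ f : (k : Fin r) → BinaryForm (d k),
      (DirectSum.linearEquivFunOnFintype ℂ (Fin r) fun k => BinaryForm (d k)).symm f p.1 = f p.1 :=
    fun f => congrFun (LinearEquiv.apply_symm_apply
      (DirectSum.linearEquivFunOnFintype ℂ (Fin r) fun k => BinaryForm (d k)) f) p.1
  rw [h]
  simp only [AddSubmonoidClass.coe_finsetSum, Submodule.coe_smul, coeff_sum, coeff_smul,
    coeff_monomial, expo_inj, smul_eq_mul]
  rw [Finset.sum_eq_single p.2]
  · simp
  · intro i _ hi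
    rw [if_neg, mul_zero]
    exact fun h => hi (Fin.ext h.1)
  · simp

/-- The linear isomorphism of `V` with `ℂ^Θ`. -/
noncomputable def coordEquiv : (⨁ k : Fin r, BinaryForm (d k)) ≃ₗ[ℂ] (Theta d → ℂ) :=
  LinearEquiv.ofBijective (coord d) ⟨coord_injective d, coord_surjective d⟩

/-- `X₀ ∂/∂X₁` sends the coefficient with index `j` to index `j + 1`, so the derivative of
coordinate `j + 1` involves coordinate `j`: upper unipotents give `lower` on coordinates, and lower
ones give `raise`. -/
theorem hasDerivAt_coord_upperUni (v : ⨁ k : Fin r, BinaryForm (d k)) (s : ℂ) (p : Theta d) :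
    HasDerivAt (fun s => coord d (rep d (upperUni s) v) p)
      (eval (coord d (rep d (upperUni s) v)) (lower d (X p))) s := by
  refine (hasDerivAt_coeff_upperUni (v p.1).1 (expo p.2 (d p.1 - p.2)) s).congr_deriv ?_
  obtain ⟨k, ⟨j, hj⟩⟩ := p
  rw [X_eq_xvar]
  cases j with
  | zero =>
    rw [lower_xvar_zero, coeff_derE_zero, map_zero]
  | succ j =>
    rw [lower_xvar_succ, coeff_derE_succ, smul_eval, xvar, dif_pos (Nat.lt_of_succ_lt hj), eval_X, coord_rep]
    simp only
    rw [show d k - (j + 1) + 1 = d k - j by omega, ← Nat.cast_add_one,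
      show d k - (j + 1) + 1 = d k - j by omega, Nat.cast_sub (by omega)]

theorem hasDerivAt_coord_lowerUni (v : ⨁ k : Fin r, BinaryForm (d k)) (s : ℂ) (p : Theta d) :
    HasDerivAt (fun s => coord d (rep d (lowerUni s) v) p)
      (eval (coord d (rep d (lowerUni s) v)) (raise d (X p))) s := by
  refine (hasDerivAt_coeff_lowerUni (v p.1).1 (expo p.2 (d p.1 - p.2)) s).congr_deriv ?_
  obtain ⟨k, ⟨j, hj⟩⟩ := p
  rw [X_eq_xvar, raise_xvar, smul_eval]
  simp only
  by_cases h : j < d k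
  · rw [xvar, dif_pos (by omega), eval_X, coord_rep]
    simp only
    obtain ⟨e, he⟩ : ∃ e, d k - j = e + 1 := ⟨d k - j - 1, by omega⟩
    rw [he, coeff_derF_succ, show d k - (j + 1) = e by omega]
  · rw [xvar, dif_neg (by omega), show d k - j = 0 by omega, coeff_derF_zero, map_zero, mul_zero]

/-! ### Polynomial functions as polynomials in the coordinates -/

/-- The function on `V` given by a polynomial in the coordinates. -/
noncomputable def evalFun :
    MvPolynomial (Theta d) ℂ →ₐ[ℂ] ((⨁ k : Fin r, BinaryForm (d k)) → ℂ) :=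
  aeval fun p v => coord d v p

theorem evalFun_apply (P : MvPolynomial (Theta d) ℂ) (v : ⨁ k : Fin r, BinaryForm (d k)) :
    evalFun d P v = eval (coord d v) P := by
  induction P using MvPolynomial.induction_on with
  | C a => simp [evalFun]
  | add p q hp hq => simp [hp, hq]
  | mul_X p i hp => rw [map_mul, Pi.mul_apply, hp, map_mul, eval_X, evalFun, aeval_X]

theorem evalFun_injective : Function.Injective (evalFun d) := by
  intro P Q h
  refine MvPolynomial.funext fun x => ?_
  obtain ⟨v, rfl⟩ := coord_surjective d x
  rw [← evalFun_apply, ← evalFun_apply, h]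

theorem range_evalFun : (evalFun d).range = polyFun (⨁ k : Fin r, BinaryForm (d k)) := by
  rw [evalFun, ← Algebra.adjoin_range_eq_range_aeval]
  refine le_antisymm (Algebra.adjoin_mono ?_) (Algebra.adjoin_le ?_)
  · rintro _ ⟨p, rfl⟩
    exact ⟨(LinearMap.proj p).comp (coord d), rfl⟩
  · rintro _ ⟨l, rfl⟩
    have h : (l : (⨁ k : Fin r, BinaryForm (d k)) → ℂ) =
        ∑ p, l ((coordEquiv d).symm (Pi.single p 1)) • fun v => coord d v p := by
      ext v
      have h1 : v = ∑ p, coord d v p • (coordEquiv d).symm (Pi.single p 1) := by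
        apply (coordEquiv d).injective
        rw [map_sum]
        simp only [map_smul, LinearEquiv.apply_symm_apply]
        exact pi_eq_sum_univ' _
      conv_lhs => rw [h1]
      simp [mul_comm]
    change (l : (⨁ k : Fin r, BinaryForm (d k)) → ℂ) ∈ _
    rw [h]
    exact sum_mem fun p _ => Subalgebra.smul_mem _ (Algebra.subset_adjoin (Set.mem_range_self p)) _

/-- Differentiate the invariance along the curve at `s = 0`. -/
theorem derivation_eq_zero_of_invariant {u : ℂ → SL2} (hu : u 0 = 1)
    {D : Derivation ℂ (MvPolynomial (Theta d) ℂ) (MvPolynomial (Theta d) ℂ)}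
    (hD : ∀ v s p, HasDerivAt (fun s => coord d (rep d (u s) v) p)
      (eval (coord d (rep d (u s) v)) (D (X p))) s) {P : MvPolynomial (Theta d) ℂ}
    (hP : ∀ s v, evalFun d P (rep d (u s) v) = evalFun d P v) : D P = 0 := by
  refine MvPolynomial.funext fun x => ?_
  obtain ⟨v, rfl⟩ := coord_surjective d x
  have h1 := hasDerivAt_eval D (hD v 0) P
  simp only [← evalFun_apply, hP] at h1
  rw [hu, map_one, Module.End.one_apply] at h1
  rw [← evalFun_apply, map_zero]
  exact h1.unique (hasDerivAt_const _ _)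

/-- The derivative vanishes along the whole curve, so the function is constant on it. -/
theorem invariant_of_derivation_eq_zero {u : ℂ → SL2} (hu : u 0 = 1)
    {D : Derivation ℂ (MvPolynomial (Theta d) ℂ) (MvPolynomial (Theta d) ℂ)}
    (hD : ∀ v s p, HasDerivAt (fun s => coord d (rep d (u s) v) p)
      (eval (coord d (rep d (u s) v)) (D (X p))) s) {P : MvPolynomial (Theta d) ℂ}
    (hP : D P = 0) (s : ℂ) (v : ⨁ k : Fin r, BinaryForm (d k)) :
    evalFun d P (rep d (u s) v) = evalFun d P v := by
  have h1 := fun s => hasDerivAt_eval D (hD v s) P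
  simp only [hP, map_zero] at h1
  have h2 := is_const_of_deriv_eq_zero (fun s => (h1 s).differentiableAt)
    (fun s => (h1 s).deriv) s 0
  rw [hu, map_one, Module.End.one_apply] at h2
  rw [evalFun_apply, evalFun_apply, h2]

theorem invariant_iff (P : MvPolynomial (Theta d) ℂ) :
    (∀ g v, evalFun d P (rep d g v) = evalFun d P v) ↔ raise d P = 0 ∧ lower d P = 0 := by
  constructor
  · intro h
    exact ⟨derivation_eq_zero_of_invariant d lowerUni_zero (hasDerivAt_coord_lowerUni d)
        fun s v => h _ v,
      derivation_eq_zero_of_invariant d upperUni_zero (hasDerivAt_coord_upperUni d)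
        fun s v => h _ v⟩
  · rintro ⟨h1, h2⟩ g
    have hg : g ∈ Subgroup.closure (Set.range upperUni ∪ Set.range lowerUni) := by
      rw [closure_uni]
      trivial
    induction hg using Subgroup.closure_induction with
    | mem g hg =>
      rcases hg with ⟨s, rfl⟩ | ⟨s, rfl⟩
      · exact invariant_of_derivation_eq_zero d upperUni_zero (hasDerivAt_coord_upperUni d) h2 s
      · exact invariant_of_derivation_eq_zero d lowerUni_zero (hasDerivAt_coord_lowerUni d) h1 s
    | one => simp
    | mul a b _ _ ha hb =>
      intro v
      rw [map_mul, Module.End.mul_apply, ha, hb]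
    | inv a _ ha =>
      intro v
      rw [← ha, ← Module.End.mul_apply, ← map_mul, mul_inv_cancel, map_one, Module.End.one_apply]

/-- Euler's identity: differentiate `c ↦ P(c v)` at `c = 1`. Conversely, the eigenvalue equation
fixes the degree of every monomial. -/
theorem homogeneous_iff (n : ℕ) (P : MvPolynomial (Theta d) ℂ) :
    (∀ (c : ℂ) v, evalFun d P (c • v) = c ^ n * evalFun d P v) ↔
      euler _ P = (n : ℂ) • P := by
  constructor
  · intro h
    refine MvPolynomial.funext fun x => ?_
    obtain ⟨v, rfl⟩ := coord_surjective d x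
    have h1 := hasDerivAt_eval (euler (Theta d)) (x := fun c => c • coord d v) (s := 1)
      (fun p => by simpa [diagDer] using (hasDerivAt_id (1 : ℂ)).mul_const (coord d v p)) P
    simp only [← map_smul, ← evalFun_apply, h] at h1
    have h2 := (hasDerivAt_pow n (1 : ℂ)).mul_const (evalFun d P v)
    have h3 := h1.unique h2
    simp only [one_smul, one_pow, mul_one] at h3
    rw [← evalFun_apply, h3, smul_eval, evalFun_apply]
  · intro h c v
    rw [diagDer_eq_smul_iff] at h
    rw [evalFun_apply, evalFun_apply, eval_eq', eval_eq', Finset.mul_sum]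
    refine Finset.sum_congr rfl fun α hα => ?_
    have h1 : ∑ p, α p = n := by
      have := h α hα
      simp only [mul_one] at this
      exact_mod_cast this
    simp only [map_smul, Pi.smul_apply, smul_eq_mul, mul_pow]
    rw [Finset.prod_mul_distrib, Finset.prod_pow_eq_pow_sum, h1]
    ring

/-- The dimension of the space of invariants of degree `n` is the difference of the dimensions of
the weight spaces of weights `0` and `2`. -/
theorem finrank_invariantRingDeg (n : ℕ) :
    Module.finrank ℂ (invariantRingDeg (rep d) n) + (wset d n 2).card = (wset d n 0).card := by
  rw [← finrank_ker_raise_wspace]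
  congr 1
  have h : invariantRingDeg (rep d) n =
      (wspace d n 0 ⊓ LinearMap.ker (raise d).toLinearMap).map (evalFun d).toLinearMap := by
    ext f
    constructor
    · rintro ⟨⟨h1, h2⟩, h3⟩
      rw [← range_evalFun] at h1
      obtain ⟨P, rfl⟩ := h1
      exact ⟨P, (mem_inf_ker_raise_iff d n P).mpr
        ⟨(homogeneous_iff d n P).mp h3, (invariant_iff d P).mp h2⟩, rfl⟩
    · rintro ⟨P, hP, rfl⟩
      have hP' := (mem_inf_ker_raise_iff d n P).mp hP
      refine ⟨⟨?_, (invariant_iff d P).mpr hP'.2⟩, (homogeneous_iff d n P).mpr hP'.1⟩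
      rw [← range_evalFun]
      exact ⟨P, rfl⟩
  rw [h, (Submodule.equivMapOfInjective (evalFun d).toLinearMap (evalFun_injective d) _).finrank_eq]

end Coordinates

/-! ### The Molien–Weyl formula -/

section Generating

open PowerSeries

theorem hasSum_coeff_mul {f g : PowerSeries ℂ} {t x y : ℂ}
    (hf : Summable fun n => ‖coeff n f * t ^ n‖) (hx : HasSum (fun n => coeff n f * t ^ n) x)
    (hg : Summable fun n => ‖coeff n g * t ^ n‖) (hy : HasSum (fun n => coeff n g * t ^ n) y) :
    (Summable fun n => ‖coeff n (f * g) * t ^ n‖) ∧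
      HasSum (fun n => coeff n (f * g) * t ^ n) (x * y) := by
  have h : ∀ n, coeff n (f * g) * t ^ n = ∑ kl ∈ Finset.HasAntidiagonal.antidiagonal n,
      (coeff kl.1 f * t ^ kl.1) * (coeff kl.2 g * t ^ kl.2) := by
    intro n
    rw [coeff_mul, Finset.sum_mul]
    refine Finset.sum_congr rfl fun kl hkl => ?_
    rw [← Finset.HasAntidiagonal.mem_antidiagonal.mp hkl, pow_add]
    ring
  simp only [h]
  have h1 := summable_norm_sum_mul_antidiagonal_of_summable_norm hf hg
  refine ⟨h1, ?_⟩
  rw [← hx.tsum_eq, ← hy.tsum_eq, tsum_mul_tsum_eq_tsum_sum_antidiagonal_of_summable_norm hf hg]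
  exact h1.of_norm.hasSum

/-- The generating function of the complete homogeneous symmetric polynomials. -/
theorem hasSum_complete_homogeneous {ι : Type*} [DecidableEq ι] (s : Finset ι) (x : ι → ℂ) (t : ℂ)
    (h : ∀ p ∈ s, ‖x p * t‖ < 1) :
    (Summable fun n => ‖(∑ α ∈ s.finsuppAntidiag n, ∏ p ∈ s, x p ^ α p) * t ^ n‖) ∧
      HasSum (fun n => (∑ α ∈ s.finsuppAntidiag n, ∏ p ∈ s, x p ^ α p) * t ^ n)
        (∏ p ∈ s, (1 - x p * t)⁻¹) := by
  -- The sums are coefficients of a product of geometric power series, so the factors can be added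
  -- one at a time by Cauchy products.
  have key : ∀ u ⊆ s,
      (Summable fun n => ‖coeff n (∏ p ∈ u, (mk fun n => x p ^ n)) * t ^ n‖) ∧
        HasSum (fun n => coeff n (∏ p ∈ u, (mk fun n => x p ^ n)) * t ^ n)
        (∏ p ∈ u, (1 - x p * t)⁻¹) := by
    intro u
    induction u using Finset.induction_on with
    | empty =>
      intro _
      have h0 : ∀ n ∉ ({0} : Finset ℕ),
          coeff n (∏ p ∈ (∅ : Finset ι), (mk fun n => x p ^ n)) * t ^ n = 0 := by
        intro n hn
        simp only [Finset.mem_singleton] at hn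
        rw [Finset.prod_empty, coeff_one, if_neg hn, zero_mul]
      constructor
      · exact summable_of_ne_finset_zero (s := {0}) fun n hn => by rw [h0 n hn, norm_zero]
      · have h1 := hasSum_sum_of_ne_finset_zero (L := .unconditional ℕ) h0
        simpa using h1
    | insert a u ha ih =>
      intro hu
      have hu' := Finset.insert_subset_iff.mp hu
      obtain ⟨h1, h2⟩ := ih hu'.2
      rw [Finset.prod_insert ha, Finset.prod_insert ha]
      have h3 := h a hu'.1
      have h4 : ∀ n, coeff n (mk fun n => x a ^ n) * t ^ n = (x a * t) ^ n := by
        intro n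
        rw [coeff_mk, mul_pow]
      refine hasSum_coeff_mul ?_ ?_ h1 h2
      · simp only [h4]
        exact summable_norm_geometric_of_norm_lt_one h3
      · simp only [h4]
        exact hasSum_geometric_of_norm_lt_one h3
  simpa only [coeff_prod, coeff_mk] using key s subset_rfl

end Generating

/-! ### The Hilbert series as a contour integral -/

section HilbertSeries

variable {r : ℕ} (d : Fin r → ℕ)

theorem summable_card_finsuppAntidiag {ι : Type*} [DecidableEq ι] (s : Finset ι) {t : ℂ}
    (ht : ‖t‖ < 1) : Summable fun n => ((s.finsuppAntidiag n).card : ℝ) * ‖t‖ ^ n := by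
  simpa using (hasSum_complete_homogeneous s (fun _ => 1) t (fun _ _ => by simpa using ht)).1

theorem summable_hilbTerm {t : ℂ} (ht : ‖t‖ < 1) : Summable (hilbTerm (rep d) t) := by
  refine Summable.of_norm_bounded (summable_card_finsuppAntidiag (Finset.univ : Finset (Theta d)) ht)
    fun n => ?_
  rw [hilbTerm, norm_mul, norm_pow, Complex.norm_natCast]
  gcongr
  have h := finrank_invariantRingDeg d n
  have h' : (wset d n 0).card ≤ (Finset.univ.finsuppAntidiag n).card :=
    Finset.card_filter_le _ _
  omega

theorem circleIntegral_zpow (n : ℤ) :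
    (∮ z in C(0, 1), z ^ n) = if n = -1 then 2 * Real.pi * Complex.I else 0 := by
  split_ifs with h
  · subst h
    simpa using circleIntegral.integral_sub_center_inv 0 (one_ne_zero (α := ℝ))
  · simpa using circleIntegral.integral_sub_zpow_of_ne h 0 0 1

theorem circleIntegrable_zpow (n : ℤ) : CircleIntegrable (fun z => z ^ n) 0 1 := by
  refine ContinuousOn.circleIntegrable zero_le_one fun z hz => ?_
  refine (continuousAt_zpow₀ z n (Or.inl ?_)).continuousWithinAt
  rintro rfl
  simp at hz

theorem ne_zero_of_mem_unit_sphere {z : ℂ} (hz : z ∈ Metric.sphere (0 : ℂ) 1) : z ≠ 0 := by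
  rintro rfl
  simp at hz

/-- Only the exponent `-1` survives integration. The factor `1 - z²` thus counts weight `0`
positively and weight `2` negatively, as in the dimension formula. -/
theorem circleIntegral_weight (w : ℤ) :
    (∮ z in C(0, 1), (1 - z ^ 2) * z⁻¹ * z ^ (-w)) =
      2 * Real.pi * Complex.I * ((if w = 0 then 1 else 0) - (if w = 2 then 1 else 0)) := by
  have h : Set.EqOn (fun z : ℂ => (1 - z ^ 2) * z⁻¹ * z ^ (-w))
      (fun z => z ^ (-1 - w) - z ^ (1 - w)) (Metric.sphere 0 1) := by
    intro z hz
    have hz0 := ne_zero_of_mem_unit_sphere hz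
    simp only
    rw [sub_eq_add_neg (-1) w, sub_eq_add_neg 1 w, zpow_add₀ hz0, zpow_add₀ hz0, zpow_neg_one,
      zpow_one]
    field_simp
  rw [circleIntegral.integral_congr zero_le_one h,
    circleIntegral.integral_sub (circleIntegrable_zpow _) (circleIntegrable_zpow _),
    circleIntegral_zpow, circleIntegral_zpow, mul_sub, mul_ite, mul_ite, mul_one, mul_zero]
  congr 2 <;> simp only [eq_iff_iff] <;> omega

/-- The integrand of the Molien–Weyl formula. -/
noncomputable def weylIntegrand (s : Theta d → ℂ) (z : ℂ) : ℂ :=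
  (1 - z ^ 2) * z⁻¹ * ∏ p, (1 - z ^ (-weight d p) * s p)⁻¹

theorem zpow_sum {ι : Type*} {z : ℂ} (hz : z ≠ 0) (s : Finset ι) (f : ι → ℤ) :
    z ^ (∑ i ∈ s, f i) = ∏ i ∈ s, z ^ f i := by
  classical
  induction s using Finset.induction_on with
  | empty => simp
  | insert a s ha ih => rw [Finset.sum_insert ha, Finset.prod_insert ha, zpow_add₀ hz, ih]

theorem prod_zpow_weight {z : ℂ} (hz : z ≠ 0) (α : Theta d →₀ ℕ) :
    ∏ p, (z ^ (-weight d p)) ^ α p = z ^ (-∑ p, (α p : ℤ) * weight d p) := by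
  rw [← Finset.sum_neg_distrib, zpow_sum hz]
  refine Finset.prod_congr rfl fun p _ => ?_
  rw [← zpow_natCast, ← zpow_mul]
  congr 1
  ring

/-- The Molien–Weyl formula. -/
theorem circleIntegral_weylIntegrand {t : ℂ} (ht : ‖t‖ < 1) :
    (∮ z in C(0, 1), weylIntegrand d (fun _ => t) z) =
      2 * Real.pi * Complex.I * hilb (rep d) t := by
  -- The degree `n` part of the integrand, expanded in powers of `t`.
  let f : ℕ → ℂ → ℂ := fun n z => (1 - z ^ 2) * z⁻¹ *
    ((∑ α ∈ Finset.univ.finsuppAntidiag n, ∏ p : Theta d, (z ^ (-weight d p)) ^ α p) * t ^ n)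
  have hcont : ∀ n, ContinuousOn (f n) (Metric.sphere 0 1) := by
    intro n z hz
    have hz0 := ne_zero_of_mem_unit_sphere hz
    refine ContinuousAt.continuousWithinAt ?_
    refine ContinuousAt.mul (by fun_prop (disch := exact hz0)) (ContinuousAt.mul ?_ (by fun_prop))
    refine tendsto_finsetSum _ fun α _ => tendsto_finsetProd _ fun p _ => ?_
    exact (continuousAt_zpow₀ z _ (Or.inl hz0)).pow _
  have hbound : ∀ n, ∀ z ∈ Metric.sphere (0 : ℂ) 1, ‖f n z‖ ≤
      2 * (((Finset.univ : Finset (Theta d)).finsuppAntidiag n).card * ‖t‖ ^ n) := by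
    intro n z hz
    have hz1 : ‖z‖ = 1 := by simpa using hz
    rw [norm_mul, norm_mul, norm_inv, hz1, inv_one, mul_one, norm_mul, norm_pow]
    gcongr
    · refine (norm_sub_le _ _).trans ?_
      rw [norm_one, norm_pow, hz1]
      norm_num
    · refine (norm_sum_le _ _).trans ?_
      refine (Finset.sum_le_card_nsmul _ _ 1 fun α _ => ?_).trans_eq (by simp)
      rw [norm_prod]
      simp [hz1]
  have hsum : ∀ z ∈ Metric.sphere (0 : ℂ) 1,
      HasSum (fun n => f n z) (weylIntegrand d (fun _ => t) z) := by
    intro z hz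
    have hz1 : ‖z‖ = 1 := by simpa using hz
    refine HasSum.mul_left _ (hasSum_complete_homogeneous Finset.univ
      (fun p => z ^ (-weight d p)) t fun p _ => ?_).2
    rwa [norm_mul, norm_zpow, hz1, one_zpow, one_mul]
  have hint : ∀ n, (∮ z in C(0, 1), f n z) = 2 * Real.pi * Complex.I * hilbTerm (rep d) t n := by
    intro n
    have h1 : Set.EqOn (f n) (fun z => t ^ n * ∑ α ∈ Finset.univ.finsuppAntidiag n,
        (1 - z ^ 2) * z⁻¹ * z ^ (-∑ p, (α p : ℤ) * weight d p)) (Metric.sphere 0 1) := by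
      intro z hz
      simp only [f]
      rw [← Finset.mul_sum, Finset.sum_congr rfl fun α _ =>
        prod_zpow_weight d (ne_zero_of_mem_unit_sphere hz) α]
      ring
    have h2 : ∀ μ : ℤ, ((wset d n μ).card : ℂ) = ∑ α ∈ Finset.univ.finsuppAntidiag n,
        if ∑ p, (α p : ℤ) * weight d p = μ then (1 : ℂ) else 0 := by
      intro μ
      rw [wset, Finset.sum_boole]
    have h3 : (Module.finrank ℂ (invariantRingDeg (rep d) n) : ℂ) =
        (wset d n 0).card - (wset d n 2).card := by
      rw [← finrank_invariantRingDeg d n]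
      push_cast
      ring
    rw [circleIntegral.integral_congr zero_le_one h1, circleIntegral.integral_const_mul,
      circleIntegral.integral_fun_sum, Finset.sum_congr rfl fun α _ => circleIntegral_weight _,
      hilbTerm, h3, h2, h2, ← Finset.mul_sum, Finset.sum_sub_distrib]
    · ring
    · intro α _
      refine ContinuousOn.circleIntegrable zero_le_one fun z hz => ?_
      have hz0 := ne_zero_of_mem_unit_sphere hz
      exact (ContinuousAt.mul (by fun_prop (disch := exact hz0))
        (continuousAt_zpow₀ z _ (Or.inl hz0))).continuousWithinAt
  have hunif : TendstoUniformlyOn (fun (s : Finset ℕ) z => ∑ n ∈ s, f n z)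
      (fun z => ∑' n, f n z) atTop (Metric.sphere 0 1) :=
    tendstoUniformlyOn_tsum ((summable_card_finsuppAntidiag _ ht).mul_left 2) hbound
  have htend := TendstoUniformlyOn.tendsto_circleIntegral_of_continuousOn zero_le_one
    (Eventually.of_forall fun s => continuousOn_finsetSum s fun n _ => hcont n) hunif
  have h4 : ∀ s : Finset ℕ, (∮ z in C(0, 1), ∑ n ∈ s, f n z) =
      ∑ n ∈ s, 2 * Real.pi * Complex.I * hilbTerm (rep d) t n := by
    intro s
    rw [circleIntegral.integral_fun_sum fun n _ => (hcont n).circleIntegrable zero_le_one]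
    exact Finset.sum_congr rfl fun n _ => hint n
  simp only [h4] at htend
  rw [circleIntegral.integral_congr zero_le_one fun z hz => (hsum z hz).tsum_eq] at htend
  exact tendsto_nhds_unique htend ((summable_hilbTerm d ht).hasSum.mul_left _)

end HilbertSeries

/-! ### Residues at coalescing simple poles -/

section Residues

open Metric

/-- Partial fractions, obtained by dividing the identity "the Lagrange basis polynomials sum to `1`"
by the nodal product. -/
theorem inv_prod_sub_eq_sum {ι : Type*} [DecidableEq ι] {S : Finset ι} (hS : S.Nonempty)
    {c : ι → ℂ} (hc : Set.InjOn c S) {z : ℂ} (hz : ∀ i ∈ S, z ≠ c i) :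
    (∏ i ∈ S, (z - c i))⁻¹ = ∑ i ∈ S, (∏ j ∈ S.erase i, (c i - c j))⁻¹ * (z - c i)⁻¹ := by
  have h := congrArg (Polynomial.eval z) (Lagrange.sum_basis hc hS)
  rw [Polynomial.eval_finsetSum, Polynomial.eval_one] at h
  rw [← mul_one (∏ i ∈ S, (z - c i))⁻¹, ← h, Finset.mul_sum]
  refine Finset.sum_congr rfl fun i hi => ?_
  rw [Lagrange.basis, Polynomial.eval_prod, ← Finset.mul_prod_erase S _ hi]
  simp only [Lagrange.basisDivisor, Polynomial.eval_mul, Polynomial.eval_C, Polynomial.eval_sub,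
    Polynomial.eval_X]
  rw [Finset.prod_mul_distrib, Finset.prod_inv_distrib, mul_inv]
  have h0 : ∏ j ∈ S.erase i, (z - c j) ≠ 0 :=
    Finset.prod_ne_zero_iff.mpr fun j hj => sub_ne_zero.mpr (hz j (Finset.mem_of_mem_erase hj))
  field_simp

/-- The residue theorem for a disc containing only simple poles. -/
theorem circleIntegral_div_prod {ι : Type*} [DecidableEq ι] {S : Finset ι} {c : ι → ℂ}
    (hc : Set.InjOn c S) {w : ℂ} {R : ℝ} (hR : 0 ≤ R) (hcR : ∀ i ∈ S, c i ∈ ball w R) {G : ℂ → ℂ}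
    (hG : DifferentiableOn ℂ G (closedBall w R)) :
    (∮ z in C(w, R), G z / ∏ i ∈ S, (z - c i)) =
      2 * Real.pi * Complex.I * ∑ i ∈ S, G (c i) / ∏ j ∈ S.erase i, (c i - c j) := by
  rcases S.eq_empty_or_nonempty with rfl | hS
  · simp only [Finset.prod_empty, div_one, Finset.sum_empty, mul_zero]
    exact Complex.circleIntegral_eq_zero_of_differentiable_on_off_countable hR
      Set.countable_empty hG.continuousOn fun z hz =>
        (hG.mono ball_subset_closedBall).differentiableAt (isOpen_ball.mem_nhds hz.1)
  have hne : ∀ i ∈ S, ∀ z ∈ sphere w R, z - c i ≠ 0 := by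
    intro i hi z hz h
    rw [sub_eq_zero] at h
    subst h
    exact (mem_ball.mp (hcR i hi)).ne (mem_sphere.mp hz)
  have h1 : Set.EqOn (fun z => G z / ∏ i ∈ S, (z - c i))
      (fun z => ∑ i ∈ S, (∏ j ∈ S.erase i, (c i - c j))⁻¹ * ((z - c i)⁻¹ • G z))
      (sphere w R) := by
    intro z hz
    simp only
    rw [div_eq_mul_inv, inv_prod_sub_eq_sum hS hc fun i hi => sub_ne_zero.mp (hne i hi z hz),
      Finset.mul_sum]
    refine Finset.sum_congr rfl fun i _ => ?_
    rw [smul_eq_mul]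
    ring
  rw [circleIntegral.integral_congr hR h1, circleIntegral.integral_fun_sum, Finset.mul_sum]
  · refine Finset.sum_congr rfl fun i hi => ?_
    rw [circleIntegral.integral_const_mul, hG.circleIntegral_sub_inv_smul (hcR i hi), smul_eq_mul]
    ring
  · intro i hi
    refine ContinuousOn.circleIntegrable hR ?_
    exact continuousOn_const.mul (ContinuousOn.smul
      ((continuous_id.sub continuous_const).continuousOn.inv₀ (hne i hi))
      (hG.continuousOn.mono sphere_subset_closedBall))

/-- Joint continuity and compactness of the circle give uniform convergence on it. -/
theorem continuousAt_circleIntegral {X : Type*} [TopologicalSpace X] [FirstCountableTopology X]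
    {f : X → ℂ → ℂ} {x₀ : X} {c : ℂ} {R : ℝ} (hR : 0 ≤ R)
    (hf : ∀ᶠ x in 𝓝 x₀, ∀ z ∈ sphere c R, ContinuousAt (fun y : X × ℂ => f y.1 y.2) (x, z)) :
    ContinuousAt (fun x => ∮ z in C(c, R), f x z) x₀ := by
  have hcont : ∀ x z, ContinuousAt (fun y : X × ℂ => f y.1 y.2) (x, z) → ContinuousAt (f x) z := by
    intro x z h
    exact h.comp (f := fun z => (x, z)) (by fun_prop)
  refine TendstoUniformlyOn.tendsto_circleIntegral_of_continuousOn hR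
    (hf.mono fun x hx z hz => (hcont x z (hx z hz)).continuousWithinAt) ?_
  rw [Metric.tendstoUniformlyOn_iff]
  intro ε hε
  refine (isCompact_sphere c R).eventually_forall_of_forall_eventually fun z hz => ?_
  have h := hf.self_of_nhds z hz
  have h1 : ContinuousAt (fun y : X × ℂ => dist (f x₀ y.2) (f y.1 y.2)) (x₀, z) := by
    refine Filter.Tendsto.dist ?_ h
    exact (hcont x₀ z h).comp (f := fun y : X × ℂ => y.2) continuousAt_snd
  refine h1.eventually_lt_const ?_
  simpa using hε

/-- The entire function `(1 - exp (-x)) / x`. -/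
noncomputable def expQuot : ℂ → ℂ := dslope (fun x => 1 - Complex.exp (-x)) 0

theorem mul_expQuot (x : ℂ) : x * expQuot x = 1 - Complex.exp (-x) := by
  simpa [expQuot] using sub_smul_dslope (fun x => 1 - Complex.exp (-x)) 0 x

theorem differentiable_expQuot : Differentiable ℂ expQuot := by
  rw [← differentiableOn_univ, expQuot, Complex.differentiableOn_dslope univ_mem]
  fun_prop

theorem expQuot_zero : expQuot 0 = 1 := by
  rw [expQuot, dslope_same]
  have h : HasDerivAt (fun x => 1 - Complex.exp (-x)) (-(Complex.exp (-0) * (-1))) (0 : ℂ) :=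
    ((hasDerivAt_neg (0 : ℂ)).cexp).const_sub 1
  simpa using h.deriv

/-- The zeros of `1 - exp (-x)` lie in `2πiℤ`; the only one in the disc is `0`, and there the
quotient is `1`. -/
theorem expQuot_ne_zero {x : ℂ} (hx : ‖x‖ < 2 * Real.pi) : expQuot x ≠ 0 := by
  rcases eq_or_ne x 0 with rfl | h0
  · rw [expQuot_zero]
    exact one_ne_zero
  intro h
  have h1 := mul_expQuot x
  rw [h, mul_zero, eq_comm, sub_eq_zero, eq_comm, Complex.exp_eq_one_iff] at h1
  obtain ⟨n, hn⟩ := h1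
  rw [← norm_neg, hn] at hx
  simp only [norm_mul, Complex.norm_intCast, Complex.norm_ofNat, Complex.norm_real, Complex.norm_I,
    mul_one, Real.norm_eq_abs, abs_of_pos Real.pi_pos] at hx
  have h2 : |(n : ℝ)| < 1 := by
    have := Real.pi_pos
    nlinarith
  have h3 : n = 0 := by
    rw [← Int.cast_abs] at h2
    exact Int.abs_lt_one_iff.mp (by exact_mod_cast h2)
  rw [h3] at hn
  simp at hn
  exact h0 hn

/-! ### Clusters of poles in the logarithmic coordinate -/

variable {ι : Type*} (ζ : ℂ) (a : ι → ℤ)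

/-- The factor `1 - ζ^(-a_p) exp (σ_p - b_p w)` for `q = (σ, b)`. -/
noncomputable def expFactor (q : (ι → ℂ) × (ι → ℂ)) (p : ι) (w : ℂ) : ℂ :=
  1 - ζ ^ (-a p) * Complex.exp (q.1 p - q.2 p * w)

/-- The zero `σ_p / b_p` of the factor with index `p` when `ζ ^ a_p = 1`. -/
noncomputable def pole (q : (ι → ℂ) × (ι → ℂ)) (p : ι) : ℂ := q.1 p / q.2 p

/-- The residue at the pole with index `P`. -/
noncomputable def residue [Fintype ι] [DecidableEq ι] (q : (ι → ℂ) × (ι → ℂ)) (P : ι) : ℂ :=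
  (1 - ζ ^ 2 * Complex.exp (2 * pole q P)) /
    (q.2 P * ∏ p ∈ Finset.univ.erase P, expFactor ζ a q p (pole q P))

variable {ζ a}

theorem continuous_expFactor (p : ι) :
    Continuous fun y : ((ι → ℂ) × (ι → ℂ)) × ℂ => expFactor ζ a y.1 p y.2 := by
  unfold expFactor
  fun_prop

/-- This isolates the linear factor responsible for the pole; the cofactor is zero-free near it,
uniformly in the parameters. -/
theorem expFactor_eq_mul_expQuot {q : (ι → ℂ) × (ι → ℂ)} {p : ι} (hζ : ζ ^ a p = 1)
    (hq : q.2 p ≠ 0) (w : ℂ) :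
    expFactor ζ a q p w = q.2 p * expQuot (q.2 p * w - q.1 p) * (w - pole q p) := by
  have h : q.2 p * w - q.1 p = q.2 p * (w - pole q p) := by
    rw [pole]
    field_simp
  rw [expFactor, zpow_neg, hζ, inv_one, one_mul, ← neg_sub (q.2 p * w) (q.1 p),
    ← mul_expQuot]
  nth_rw 1 [h]
  ring

/-- The subtracted term has modulus `exp ((1 - a_p / m) Re τ)`, which is `1` only if `a_p = m`. So
poles of different weights do not meet in the limit. -/
theorem expFactor_center_ne_zero {m : ℤ} (hm : 0 < m) (hζ : ζ ^ m = 1) {τ : ℂ} (hτ : τ.re < 0)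
    {p : ι} (hp : a p ≠ m) :
    expFactor ζ a (fun _ => τ, fun p => (a p : ℂ)) p (τ / m) ≠ 0 := by
  intro h
  rw [expFactor, sub_eq_zero] at h
  have h1 := congrArg norm h
  have hζ1 : ‖ζ‖ = 1 := by
    lift m to ℕ using hm.le
    rw [zpow_natCast] at hζ
    exact Complex.norm_eq_one_of_pow_eq_one hζ (by omega)
  have h2 : τ - (a p : ℂ) * (τ / m) = ((1 - a p / m : ℝ) : ℂ) * τ := by
    push_cast
    ring
  simp only at h1
  rw [norm_one, norm_mul, norm_zpow, hζ1, one_zpow, one_mul, Complex.norm_exp, h2,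
    Complex.re_ofReal_mul, eq_comm, Real.exp_eq_one_iff, mul_eq_zero] at h1
  have hm' : (m : ℝ) ≠ 0 := by exact_mod_cast hm.ne'
  have h3 := h1.resolve_right hτ.ne
  rw [sub_eq_zero, eq_div_iff hm', one_mul] at h3
  exact hp (by exact_mod_cast h3.symm)

variable (ζ a) in
/-- Conditions on `q` under which the integral over the circle of radius `ε` about `w₀` picks up
exactly the poles with index in `S`. -/
def IsAdmissible (S : Finset ι) (w₀ : ℂ) (ε : ℝ) (q : (ι → ℂ) × (ι → ℂ)) : Prop :=
  (∀ p ∉ S, ∀ w ∈ closedBall w₀ ε, expFactor ζ a q p w ≠ 0) ∧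
    ∀ p ∈ S, q.2 p ≠ 0 ∧ pole q p ∈ ball w₀ ε ∧
      ∀ w ∈ closedBall w₀ ε, ‖q.2 p * w - q.1 p‖ < 2 * Real.pi

theorem expFactor_ne_zero_of_isAdmissible {S : Finset ι} (hS : ∀ p ∈ S, ζ ^ a p = 1) {w₀ : ℂ}
    {ε : ℝ} {q : (ι → ℂ) × (ι → ℂ)} (hq : IsAdmissible ζ a S w₀ ε q) (p : ι) {w : ℂ}
    (hw : w ∈ sphere w₀ ε) : expFactor ζ a q p w ≠ 0 := by
  have hw' := sphere_subset_closedBall hw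
  by_cases hp : p ∈ S
  · obtain ⟨h1, h2, h3⟩ := hq.2 p hp
    rw [expFactor_eq_mul_expQuot (hS p hp) h1]
    refine mul_ne_zero (mul_ne_zero h1 (expQuot_ne_zero (h3 w hw'))) (sub_ne_zero.mpr ?_)
    rintro rfl
    exact (mem_ball.mp h2).ne (mem_sphere.mp hw)
  · exact hq.1 p hp w hw'

variable [Fintype ι]

theorem eventually_isAdmissible {m : ℤ} (hm : 0 < m) (hζ : ζ ^ m = 1) {τ : ℂ} (hτ : τ.re < 0) :
    ∃ ε : ℝ, 0 < ε ∧ ∀ᶠ q in 𝓝 ((fun _ => τ, fun p => (a p : ℂ)) : (ι → ℂ) × (ι → ℂ)),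
      IsAdmissible ζ a {p | a p = m} (τ / m) ε q := by
  have hm' : (m : ℂ) ≠ 0 := by exact_mod_cast hm.ne'
  have hmR : (0 : ℝ) < m := by exact_mod_cast hm
  set q₀ : (ι → ℂ) × (ι → ℂ) := (fun _ => τ, fun p => (a p : ℂ)) with hq₀
  have h1 : ∀ᶠ w in 𝓝 (τ / (m : ℂ)), ∀ p, a p ≠ m → expFactor ζ a q₀ p w ≠ 0 := by
    rw [eventually_all]
    intro p
    by_cases hp : a p = m
    · simp [hp]
    · have hc : ContinuousAt (fun w => expFactor ζ a q₀ p w) (τ / m) := by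
        unfold expFactor
        fun_prop
      exact (hc.eventually_ne (expFactor_center_ne_zero hm hζ hτ hp)).mono fun w hw _ => hw
  obtain ⟨δ, hδ, hδ'⟩ := Metric.eventually_nhds_iff_ball.mp h1
  -- The first bound keeps the closed disc where the factors of weight different from `m` do not
  -- vanish. The second gives `m ε < 2π`, so that `m w - τ = m (w - τ / m)` stays in the zero-free
  -- disc of `expQuot`.
  refine ⟨min (δ / 2) (2 * Real.pi / (m + 1)), lt_min (half_pos hδ) (by positivity), ?_⟩
  set ε := min (δ / 2) (2 * Real.pi / ((m : ℝ) + 1)) with hε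
  have hε0 : 0 < ε := lt_min (half_pos hδ) (by positivity)
  have hεm : (m : ℝ) * ε < 2 * Real.pi := by
    have h : ε * (m + 1) ≤ 2 * Real.pi := (le_div_iff₀ (by positivity)).mp (min_le_right _ _)
    linarith
  refine Eventually.and ?_ ?_
  · rw [eventually_all]
    intro p
    by_cases hp : a p = m
    · simp [hp]
    have h2 : ∀ᶠ q in 𝓝 q₀, ∀ w ∈ closedBall (τ / (m : ℂ)) ε, expFactor ζ a q p w ≠ 0 := by
      refine (isCompact_closedBall _ _).eventually_forall_of_forall_eventually fun w hw => ?_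
      refine (continuous_expFactor p).continuousAt.eventually_ne ?_
      refine hδ' w ?_ p hp
      refine closedBall_subset_ball ?_ hw
      exact (min_le_left _ _).trans_lt (half_lt_self hδ)
    exact h2.mono fun q hq _ => hq
  · rw [eventually_all]
    intro p
    by_cases hp : a p = m
    swap
    · simp [hp]
    have hp' : q₀.2 p = m := by simp [hq₀, hp]
    have h2 : ∀ᶠ q in 𝓝 q₀, q.2 p ≠ 0 := by
      refine ContinuousAt.eventually_ne (g := fun q : (ι → ℂ) × (ι → ℂ) => q.2 p) (by fun_prop) ?_
      rw [hp']
      exact hm'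
    have h3 : ∀ᶠ q in 𝓝 q₀, pole q p ∈ ball (τ / (m : ℂ)) ε := by
      have hc : ContinuousAt (fun q : (ι → ℂ) × (ι → ℂ) => pole q p) q₀ := by
        unfold pole
        refine ContinuousAt.div (by fun_prop) (by fun_prop) ?_
        rw [hp']
        exact hm'
      refine hc.eventually_mem (isOpen_ball.mem_nhds ?_)
      rw [pole, hp']
      exact mem_ball_self hε0
    have h4 : ∀ᶠ q in 𝓝 q₀, ∀ w ∈ closedBall (τ / (m : ℂ)) ε,
        ‖q.2 p * w - q.1 p‖ < 2 * Real.pi := by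
      refine (isCompact_closedBall _ _).eventually_forall_of_forall_eventually fun w hw => ?_
      have hc : ContinuousAt (fun y : ((ι → ℂ) × (ι → ℂ)) × ℂ => ‖y.1.2 p * y.2 - y.1.1 p‖)
        (q₀, w) := by fun_prop
      refine hc.eventually_lt_const ?_
      simp only
      have h5 : q₀.2 p * w - q₀.1 p = m * (w - τ / m) := by
        rw [hp', mul_sub, mul_div_cancel₀ _ hm']
      rw [h5, norm_mul, Complex.norm_intCast, abs_of_pos hmR, ← dist_eq_norm]
      exact (mul_le_mul_of_nonneg_left (mem_closedBall.mp hw) hmR.le).trans_lt hεm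
    filter_upwards [h2, h3, h4] with q h2 h3 h4 _
    exact ⟨h2, h3, h4⟩

variable (ζ a) in
/-- The contour integral of `(1 - ζ² exp (2w)) / ∏ (1 - ζ^(-a_p) exp (σ_p - b_p w))`. -/
noncomputable def contourIntegral (w₀ : ℂ) (ε : ℝ) (q : (ι → ℂ) × (ι → ℂ)) : ℂ :=
  (2 * Real.pi * Complex.I)⁻¹ *
    ∮ w in C(w₀, ε), (1 - ζ ^ 2 * Complex.exp (2 * w)) / ∏ p, expFactor ζ a q p w

/-- No factor vanishes on the circle itself, whether or not the poles inside it collide. -/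
theorem continuousAt_contourIntegral {S : Finset ι} (hS : ∀ p ∈ S, ζ ^ a p = 1) {w₀ : ℂ} {ε : ℝ}
    (hε : 0 ≤ ε) {q₀ : (ι → ℂ) × (ι → ℂ)} (hq : ∀ᶠ q in 𝓝 q₀, IsAdmissible ζ a S w₀ ε q) :
    ContinuousAt (contourIntegral ζ a w₀ ε) q₀ := by
  refine continuousAt_const.mul (continuousAt_circleIntegral hε ?_)
  filter_upwards [hq] with q hq w hw
  refine ContinuousAt.div (by fun_prop) ?_ ?_
  · exact tendsto_finsetProd _ fun p _ => (continuous_expFactor p).continuousAt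
  · exact Finset.prod_ne_zero_iff.mpr fun p _ => expFactor_ne_zero_of_isAdmissible hS hq p hw

variable [DecidableEq ι]

theorem contourIntegral_eq_sum {S : Finset ι} (hS : ∀ p ∈ S, ζ ^ a p = 1) {w₀ : ℂ} {ε : ℝ}
    (hε : 0 ≤ ε) {q : (ι → ℂ) × (ι → ℂ)} (hq : IsAdmissible ζ a S w₀ ε q)
    (hinj : Set.InjOn (pole q) S) :
    contourIntegral ζ a w₀ ε q = ∑ P ∈ S, residue ζ a q P := by
  let H : ℂ → ℂ := fun w => (∏ p ∈ Sᶜ, expFactor ζ a q p w) *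
    ∏ p ∈ S, (q.2 p * expQuot (q.2 p * w - q.1 p))
  have hfac : ∀ w, ∏ p, expFactor ζ a q p w = H w * ∏ p ∈ S, (w - pole q p) := by
    intro w
    rw [← Finset.prod_compl_mul_prod S, mul_assoc, ← Finset.prod_mul_distrib]
    congr 1
    exact Finset.prod_congr rfl fun p hp => expFactor_eq_mul_expQuot (hS p hp) (hq.2 p hp).1 w
  have hdiff : DifferentiableOn ℂ (fun w => (1 - ζ ^ 2 * Complex.exp (2 * w)) / H w)
      (closedBall w₀ ε) := by
    refine DifferentiableOn.div (by fun_prop) (Differentiable.differentiableOn ?_) ?_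
    · have := differentiable_expQuot
      simp only [H, expFactor]
      fun_prop
    · intro w hw
      refine mul_ne_zero (Finset.prod_ne_zero_iff.mpr fun p hp => ?_)
        (Finset.prod_ne_zero_iff.mpr fun p hp => ?_)
      · exact hq.1 p (Finset.mem_compl.mp hp) w hw
      · exact mul_ne_zero (hq.2 p hp).1 (expQuot_ne_zero ((hq.2 p hp).2.2 w hw))
  have h1 := circleIntegral_div_prod hinj hε (fun p hp => (hq.2 p hp).2.1) hdiff
  have h2 : (2 * Real.pi * Complex.I : ℂ) ≠ 0 := Complex.two_pi_I_ne_zero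
  simp only [contourIntegral, hfac, ← div_div]
  rw [h1, inv_mul_cancel_left₀ h2]
  refine Finset.sum_congr rfl fun P hP => ?_
  rw [div_div, residue]
  congr 1
  have h3 : Finset.univ.erase P = Sᶜ ∪ S.erase P := by
    ext p
    by_cases hp : p ∈ S
    · simp [hp]
    · have : p ≠ P := fun h => hp (h ▸ hP)
      simp [hp, this]
  have h4 : Disjoint Sᶜ (S.erase P) :=
    (disjoint_compl_left (a := S)).mono_right (Finset.erase_subset P S)
  -- At its own pole `expQuot` takes the value `1`, which leaves the factor `b_P` of the residue.
  have h5 : ∏ p ∈ S, (q.2 p * expQuot (q.2 p * pole q P - q.1 p)) =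
      q.2 P * ∏ p ∈ S.erase P, (q.2 p * expQuot (q.2 p * pole q P - q.1 p)) := by
    rw [← Finset.mul_prod_erase S _ hP]
    rw [show q.2 P * pole q P - q.1 P = 0 by rw [pole, mul_div_cancel₀ _ (hq.2 P hP).1, sub_self],
      expQuot_zero, mul_one]
  have h6 : ∏ p ∈ S.erase P, expFactor ζ a q p (pole q P) =
      (∏ p ∈ S.erase P, (q.2 p * expQuot (q.2 p * pole q P - q.1 p))) *
        ∏ p ∈ S.erase P, (pole q P - pole q p) := by
    rw [← Finset.prod_mul_distrib]
    refine Finset.prod_congr rfl fun p hp => ?_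
    have hp' := Finset.mem_of_mem_erase hp
    exact expFactor_eq_mul_expQuot (hS p hp') (hq.2 p hp').1 _
  simp only [H]
  rw [h3, Finset.prod_union h4, h5, h6]
  ring

/-- The sum of the residues at the poles coalescing at `τ / m` extends continuously across the
parameters at which these poles collide. -/
theorem exists_continuous_sum_residue {m : ℤ} (hm : 0 < m) (hζ : ζ ^ m = 1) {τ : ℂ}
    (hτ : τ.re < 0) :
    ∃ C : (ι → ℂ) × (ι → ℂ) → ℂ,
      (∀ᶠ q in 𝓝 ((fun _ => τ, fun p => (a p : ℂ)) : (ι → ℂ) × (ι → ℂ)), ContinuousAt C q) ∧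
      ∀ᶠ q in 𝓝 ((fun _ => τ, fun p => (a p : ℂ)) : (ι → ℂ) × (ι → ℂ)),
        Set.InjOn (pole q) {p | a p = m} → C q = ∑ P with a P = m, residue ζ a q P := by
  obtain ⟨ε, hε, h⟩ := eventually_isAdmissible (a := a) hm hζ hτ
  have hS : ∀ p ∈ ({p | a p = m} : Finset ι), ζ ^ a p = 1 := by
    intro p hp
    rw [(Finset.mem_filter.mp hp).2, hζ]
  refine ⟨contourIntegral ζ a (τ / m) ε, ?_, ?_⟩
  · filter_upwards [h.eventually_nhds] with q hq
    exact continuousAt_contourIntegral hS hε.le hq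
  · filter_upwards [h] with q hq hinj
    exact contourIntegral_eq_sum hS hε.le hq (by simpa using hinj)

end Residues

/-! ### The residue theorem in the unit disc -/

section RootsOfUnity

open Polynomial

theorem mem_unityRoots {m : ℤ} (hm : 0 < m) {ζ : ℂ} : ζ ∈ unityRoots m ↔ ζ ^ m = 1 := by
  lift m to ℕ using hm.le
  rw [unityRoots, Int.toNat_natCast, mem_nthRootsFinset (by omega), zpow_natCast]

theorem norm_eq_one_of_mem_unityRoots {m : ℤ} (hm : 0 < m) {ζ : ℂ} (hζ : ζ ∈ unityRoots m) :
    ‖ζ‖ = 1 := by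
  rw [mem_unityRoots hm] at hζ
  lift m to ℕ using hm.le
  rw [zpow_natCast] at hζ
  exact Complex.norm_eq_one_of_pow_eq_one hζ (by omega)

theorem prod_unityRoots {m : ℤ} (hm : 0 < m) (z y : ℂ) :
    ∏ ζ ∈ unityRoots m, (z - ζ * y) = z ^ m.toNat - y ^ m.toNat :=
  ((Complex.isPrimitiveRoot_exp m.toNat (by omega)).pow_sub_pow_eq_prod_sub_mul z y
    (by omega)).symm

/-- This product is the derivative of `X^m - y^m` at the root `ζ y`. -/
theorem prod_unityRoots_erase {m : ℤ} (hm : 0 < m) {ζ : ℂ} (hζ : ζ ∈ unityRoots m) (y : ℂ) :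
    ∏ ξ ∈ (unityRoots m).erase ζ, (ζ * y - ξ * y) = m * (ζ * y) ^ (m.toNat - 1) := by
  have h1 : Lagrange.nodal (unityRoots m) (fun ξ => ξ * y) = X ^ m.toNat - C (y ^ m.toNat) := by
    refine Polynomial.funext fun z => ?_
    rw [Lagrange.eval_nodal, prod_unityRoots hm]
    simp
  have h2 := Lagrange.eval_nodal_derivative_eval_node_eq (v := fun ξ => ξ * y) hζ
  rw [Lagrange.eval_nodal, h1] at h2
  rw [← h2]
  have h3 : ((m.toNat : ℕ) : ℂ) = m := by
    lift m to ℕ using hm.le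
    simp
  rw [derivative_sub, derivative_C, sub_zero, derivative_X_pow]
  simp [h3]

end RootsOfUnity

/-! ### Simple poles in the disc and the value of the limit -/

section Global

open Metric

variable {ι : Type*} (a : ι → ℤ)

theorem prod_erase_sigma {κ M : Type*} [DecidableEq ι] [DecidableEq κ] [CommMonoid M] {S : Finset ι}
    (U : ι → Finset κ) (f : ι → κ → M) {P : ι} (hP : P ∈ S) (ζ : κ) :
    ∏ x ∈ (S.sigma U).erase ⟨P, ζ⟩, f x.1 x.2 =
      (∏ ξ ∈ (U P).erase ζ, f P ξ) * ∏ p ∈ S.erase P, ∏ ξ ∈ U p, f p ξ := by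
  have h : (S.sigma U).erase ⟨P, ζ⟩ = S.sigma fun p => if p = P then (U p).erase ζ else U p := by
    ext ⟨p, ξ⟩
    by_cases hp : p = P
    · subst hp
      simp [and_left_comm]
    · simp [hp]
  rw [h, Finset.prod_sigma, ← Finset.mul_prod_erase S _ hP, if_pos rfl]
  congr 1
  refine Finset.prod_congr rfl fun p hp => ?_
  rw [if_neg (Finset.ne_of_mem_erase hp)]

/-- The integrand of the Molien–Weyl formula for the weights `-a`, with a variable `s_p` for each
weight. -/
noncomputable def residueIntegrand [Fintype ι] (s : ι → ℂ) (z : ℂ) : ℂ :=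
  (1 - z ^ 2) * z⁻¹ * ∏ p, (1 - z ^ (-a p) * s p)⁻¹

/-- The poles of `residueIntegrand` in the unit disc. -/
noncomputable def discPole (σ : ι → ℂ) (x : (_ : ι) × ℂ) : ℂ :=
  x.2 * Complex.exp (σ x.1 / a x.1)

theorem norm_discPole (σ : ι → ℂ) {p : ι} (hp : 0 < a p) {ζ : ℂ} (hζ : ζ ∈ unityRoots (a p)) :
    ‖discPole a σ ⟨p, ζ⟩‖ = Real.exp ((σ p).re / a p) := by
  rw [discPole, norm_mul, norm_eq_one_of_mem_unityRoots hp hζ, one_mul, Complex.norm_exp,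
    Complex.div_intCast_re]

theorem one_sub_zpow_mul {z : ℂ} (hz : z ≠ 0) {m : ℤ} (hm : 0 < m) (s : ℂ) :
    1 - z ^ (-m) * s = (z ^ m.toNat)⁻¹ * (z ^ m.toNat - s) := by
  lift m to ℕ using hm.le
  rw [Int.toNat_natCast, zpow_neg, zpow_natCast, mul_sub, inv_mul_cancel₀ (pow_ne_zero _ hz)]

theorem one_sub_pow_mul_ne_zero {z s : ℂ} (hz : ‖z‖ ≤ 1) (hs : ‖s‖ < 1) (n : ℕ) :
    1 - z ^ n * s ≠ 0 := by
  intro h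
  rw [sub_eq_zero] at h
  have h1 : ‖z ^ n * s‖ < 1 := by
    rw [norm_mul, norm_pow]
    exact mul_lt_one_of_nonneg_of_lt_one_right (pow_le_one₀ (norm_nonneg _) hz) (norm_nonneg _) hs
  rw [← h, norm_one] at h1
  exact lt_irrefl _ h1

variable [Fintype ι]

theorem continuousAt_circleIntegral_residueIntegrand {σ : ι → ℂ} (hσ : ∀ p, (σ p).re < 0) :
    ContinuousAt (fun σ : ι → ℂ =>
      ∮ z in C(0, 1), residueIntegrand a (fun p => Complex.exp (σ p)) z) σ := by
  have h : ∀ᶠ σ' in 𝓝 σ, ∀ p, (σ' p).re < 0 := by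
    rw [eventually_all]
    intro p
    have hc : ContinuousAt (fun σ : ι → ℂ => (σ p).re) σ :=
      (Complex.continuous_re.comp (continuous_apply p)).continuousAt
    exact hc.eventually_lt_const (hσ p)
  refine continuousAt_circleIntegral zero_le_one ?_
  filter_upwards [h] with σ' hσ' z hz
  have hz0 := ne_zero_of_mem_unit_sphere hz
  have hz1 : ‖z‖ = 1 := by simpa using hz
  unfold residueIntegrand
  refine ContinuousAt.mul (by fun_prop (disch := exact hz0)) (tendsto_finsetProd _ fun p _ => ?_)
  refine ContinuousAt.inv₀ ?_ ?_
  · refine continuousAt_const.sub (ContinuousAt.mul ?_ (by fun_prop))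
    exact ContinuousAt.comp (g := fun z : ℂ => z ^ (-a p)) (f := fun x : (ι → ℂ) × ℂ => x.2)
      (continuousAt_zpow₀ z _ (Or.inl hz0)) continuousAt_snd
  · have h1 : ‖z ^ (-a p)‖ = 1 := by rw [norm_zpow, hz1, one_zpow]
    simpa using one_sub_pow_mul_ne_zero (s := Complex.exp (σ' p)) h1.le
      (by rw [Complex.norm_exp]; exact Real.exp_lt_one_iff.mpr (hσ' p)) 1

theorem sum_unityRoots_fiberwise (f : ι → ℂ → ℂ) :
    ∑ P with 0 < a P, ∑ ζ ∈ unityRoots (a P), f P ζ =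
      ∑ m ∈ (Finset.univ.image a).filter (0 < ·), ∑ ζ ∈ unityRoots m, ∑ P with a P = m, f P ζ := by
  have hmaps : ∀ P ∈ ({P | 0 < a P} : Finset ι), a P ∈ (Finset.univ.image a).filter (0 < ·) := by
    intro P hP
    simpa using hP
  rw [← Finset.sum_fiberwise_of_maps_to hmaps]
  refine Finset.sum_congr rfl fun m hm => ?_
  have hm0 := (Finset.mem_filter.mp hm).2
  have h : ({P | 0 < a P} : Finset ι).filter (fun P => a P = m) = ({P | a P = m} : Finset ι) := by
    ext P
    simp only [Finset.mem_filter, Finset.mem_univ, true_and]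
    exact ⟨fun h => h.2, fun h => ⟨h ▸ hm0, h⟩⟩
  rw [h, Finset.sum_comm]
  refine Finset.sum_congr rfl fun P hP => ?_
  rw [(Finset.mem_filter.mp hP).2]

variable [DecidableEq ι]

/-- Factors of nonpositive weight have no zero in the closed disc, since `‖exp σ_p‖ < 1`. Clearing
negative powers in the others produces `z ^ A`, which absorbs `z⁻¹` because some weight is positive,
so `0` is not a pole. -/
theorem circleIntegral_residueIntegrand {σ : ι → ℂ} (hσ : ∀ p, (σ p).re < 0) (hne : ∃ p, 0 < a p)
    (hinj : Set.InjOn (discPole a σ)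
      (({p | 0 < a p} : Finset ι).sigma fun p => unityRoots (a p))) :
    (∮ z in C(0, 1), residueIntegrand a (fun p => Complex.exp (σ p)) z) =
      2 * Real.pi * Complex.I * ∑ P with 0 < a P, ∑ ζ ∈ unityRoots (a P),
        residue ζ a (σ, fun p => (a p : ℂ)) P := by
  set S : Finset ι := {p | 0 < a p} with hS
  have hmem : ∀ p, p ∈ S ↔ 0 < a p := fun p => by simp [hS]
  set A := ∑ p ∈ S, (a p).toNat with hA
  have hA1 : 0 < A := by
    obtain ⟨p, hp⟩ := hne
    exact Finset.sum_pos' (fun _ _ => Nat.zero_le _) ⟨p, (hmem p).mpr hp, by omega⟩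
  let s : ι → ℂ := fun p => Complex.exp (σ p)
  have hs : ∀ p, ‖s p‖ < 1 := fun p => by
    rw [Complex.norm_exp]
    exact Real.exp_lt_one_iff.mpr (hσ p)
  let D : ℂ → ℂ := fun z => ∏ p ∈ Sᶜ, (1 - z ^ (-a p).toNat * s p)
  let G : ℂ → ℂ := fun z => (1 - z ^ 2) * z ^ (A - 1) / D z
  have hD : ∀ z, ‖z‖ ≤ 1 → D z ≠ 0 := fun z hz =>
    Finset.prod_ne_zero_iff.mpr fun p _ => one_sub_pow_mul_ne_zero hz (hs p) _
  have hDeq : ∀ z, ∏ p ∈ Sᶜ, (1 - z ^ (-a p) * s p) = D z := by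
    intro z
    refine Finset.prod_congr rfl fun p hp => ?_
    rw [Finset.mem_compl, hmem, not_lt] at hp
    rw [← zpow_natCast, Int.toNat_of_nonneg (by omega)]
  have hG : DifferentiableOn ℂ G (closedBall 0 1) := by
    refine DifferentiableOn.div (by fun_prop) (by simp only [D]; fun_prop) fun z hz => ?_
    exact hD z (by simpa using hz)
  have hpos : ∀ T ⊆ S, ∀ z : ℂ, z ≠ 0 → ∏ p ∈ T, (1 - z ^ (-a p) * s p) =
      (z ^ (∑ p ∈ T, (a p).toNat))⁻¹ * ∏ p ∈ T, (z ^ (a p).toNat - s p) := by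
    intro T hT z hz
    rw [← Finset.prod_pow_eq_pow_sum, ← Finset.prod_inv_distrib, ← Finset.prod_mul_distrib]
    exact Finset.prod_congr rfl fun p hp => one_sub_zpow_mul hz ((hmem p).mp (hT hp)) _
  have hroots : ∀ p ∈ S, ∀ z : ℂ, ∏ ζ ∈ unityRoots (a p), (z - discPole a σ ⟨p, ζ⟩) =
      z ^ (a p).toNat - s p := by
    intro p hp z
    rw [hmem] at hp
    simp only [discPole, s]
    rw [prod_unityRoots hp, ← Complex.exp_nat_mul]
    congr 2
    have h1 : ((a p).toNat : ℂ) = a p := by exact_mod_cast Int.toNat_of_nonneg hp.le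
    have h2 : (a p : ℂ) ≠ 0 := by exact_mod_cast hp.ne'
    rw [h1]
    field_simp
  have hint : Set.EqOn (residueIntegrand a s)
      (fun z => G z / ∏ x ∈ S.sigma fun p => unityRoots (a p), (z - discPole a σ x))
      (sphere 0 1) := by
    intro z hz
    have hz0 := ne_zero_of_mem_unit_sphere hz
    have h1 : z ^ A = z ^ (A - 1) * z := by rw [← pow_succ, Nat.sub_add_cancel hA1]
    simp only [residueIntegrand, G]
    rw [Finset.prod_sigma, Finset.prod_congr rfl fun p hp => hroots p hp z,
      Finset.prod_inv_distrib, ← Finset.prod_compl_mul_prod S, hDeq, hpos S subset_rfl z hz0, ← hA,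
      h1, mul_inv, mul_inv, inv_inv, div_div, div_eq_mul_inv, mul_inv]
    field_simp
  rw [circleIntegral.integral_congr zero_le_one hint,
    circleIntegral_div_prod hinj zero_le_one ?_ hG, Finset.sum_sigma]
  · congr 1
    refine Finset.sum_congr rfl fun P hP => Finset.sum_congr rfl fun ζ hζ => ?_
    have haP := (hmem P).mp hP
    set c := discPole a σ ⟨P, ζ⟩ with hc
    have hζ0 : ζ ≠ 0 := by
      rw [← norm_ne_zero_iff, norm_eq_one_of_mem_unityRoots haP hζ]
      exact one_ne_zero
    have hc0 : c ≠ 0 := mul_ne_zero hζ0 (Complex.exp_ne_zero _)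
    have h1 : ∏ ξ ∈ (unityRoots (a P)).erase ζ, (c - discPole a σ ⟨P, ξ⟩) =
        a P * c ^ ((a P).toNat - 1) := prod_unityRoots_erase haP hζ _
    have h2 : ∏ p ∈ S.erase P, ∏ ξ ∈ unityRoots (a p), (c - discPole a σ ⟨p, ξ⟩) =
        ∏ p ∈ S.erase P, (c ^ (a p).toNat - s p) :=
      Finset.prod_congr rfl fun p hp => hroots p (Finset.mem_of_mem_erase hp) c
    have h3 : ∀ p, expFactor ζ a (σ, fun p => (a p : ℂ)) p (pole (σ, fun p => (a p : ℂ)) P) =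
        1 - c ^ (-a p) * s p := by
      intro p
      simp only [expFactor, pole, hc, discPole, s]
      rw [mul_zpow, ← Complex.exp_int_mul, mul_assoc, ← Complex.exp_add]
      congr 3
      push_cast
      ring_nf
    have h4 : ζ ^ 2 * Complex.exp (2 * pole (σ, fun p => (a p : ℂ)) P) = c ^ 2 := by
      rw [hc, discPole, mul_pow, ← Complex.exp_nat_mul]
      rfl
    have h5 : Finset.univ.erase P = Sᶜ ∪ S.erase P := by
      ext p
      by_cases hp : p ∈ S
      · simp [hp]
      · have : p ≠ P := fun h => hp (h ▸ hP)
        simp [hp, this]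
    have h6 : Disjoint Sᶜ (S.erase P) :=
      (disjoint_compl_left (a := S)).mono_right (Finset.erase_subset P S)
    have h7 : A - 1 = ((a P).toNat - 1) + ∑ p ∈ S.erase P, (a p).toNat := by
      rw [hA, ← Finset.add_sum_erase S _ hP]
      omega
    rw [prod_erase_sigma (fun p => unityRoots (a p)) (fun p ξ => c - discPole a σ ⟨p, ξ⟩) hP,
      h1, h2, residue, h4, Finset.prod_congr rfl fun p _ => h3 p, h5, Finset.prod_union h6, hDeq,
      hpos _ (Finset.erase_subset P S) c hc0]
    simp only [G]
    rw [h7, pow_add]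
    have h8 : c ^ ((a P).toNat - 1) ≠ 0 := pow_ne_zero _ hc0
    have h9 : c ^ (∑ p ∈ S.erase P, (a p).toNat) ≠ 0 := pow_ne_zero _ hc0
    simp only [div_eq_mul_inv, mul_inv, inv_inv]
    field_simp
  · rintro ⟨p, ζ⟩ hx
    rw [Finset.mem_sigma, hmem] at hx
    rw [mem_ball_zero_iff, norm_discPole a σ hx.1 hx.2]
    have : (0 : ℝ) < a p := by exact_mod_cast hx.1
    exact Real.exp_lt_one_iff.mpr (div_neg_of_neg_of_pos (hσ p) this)

/-- Each pair `(m, ζ)` contributes a function continuous at the limit point, so `L` is independent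
of the approach. Only poles of equal weight need to be kept apart. -/
theorem exists_tendsto_sum_residue {τ : ℂ} (hτ : τ.re < 0) :
    ∃ L : ℂ, ∀ {β : Type} (l : Filter β) (q : β → (ι → ℂ) × (ι → ℂ)),
      Tendsto q l (𝓝 (fun _ => τ, fun p => (a p : ℂ))) →
      (∀ᶠ x in l, ∀ m > 0, Set.InjOn (pole (q x)) {p | a p = m}) →
      Tendsto (fun x => ∑ P with 0 < a P, ∑ ζ ∈ unityRoots (a P), residue ζ a (q x) P) l
        (𝓝 L) := by
  have h : ∀ m : ℤ, ∀ ζ : ℂ, ∃ C : (ι → ℂ) × (ι → ℂ) → ℂ, 0 < m → ζ ^ m = 1 →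
      ContinuousAt C (fun _ => τ, fun p => (a p : ℂ)) ∧
      ∀ᶠ q in 𝓝 ((fun _ => τ, fun p => (a p : ℂ)) : (ι → ℂ) × (ι → ℂ)),
        Set.InjOn (pole q) {p | a p = m} → C q = ∑ P with a P = m, residue ζ a q P := by
    intro m ζ
    by_cases hm : 0 < m ∧ ζ ^ m = 1
    · obtain ⟨C, h1, h2⟩ := exists_continuous_sum_residue (a := a) hm.1 hm.2 hτ
      exact ⟨C, fun _ _ => ⟨h1.self_of_nhds, h2⟩⟩
    · exact ⟨0, fun h1 h2 => (hm ⟨h1, h2⟩).elim⟩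
  choose C hC using h
  refine ⟨∑ m ∈ (Finset.univ.image a).filter (0 < ·), ∑ ζ ∈ unityRoots m,
    C m ζ (fun _ => τ, fun p => (a p : ℂ)), fun l q hq hinj => ?_⟩
  simp only [sum_unityRoots_fiberwise]
  refine tendsto_finsetSum _ fun m hm => tendsto_finsetSum _ fun ζ hζ => ?_
  have hm0 := (Finset.mem_filter.mp hm).2
  obtain ⟨h1, h2⟩ := hC m ζ hm0 ((mem_unityRoots hm0).mp hζ)
  refine (h1.tendsto.comp hq).congr' ?_
  filter_upwards [hq.eventually h2, hinj] with x hx1 hx2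
  exact hx1 (hx2 m hm0)

theorem eventually_add_mul_ne_zero (α : ℝ) {β : ℝ} (hβ : β ≠ 0) :
    ∀ᶠ s in 𝓝[≠] (0 : ℝ), α + s * β ≠ 0 := by
  by_cases hα : α = 0
  · filter_upwards [self_mem_nhdsWithin] with s hs
    rw [hα, zero_add]
    exact mul_ne_zero hs hβ
  · refine nhdsWithin_le_nhds (ContinuousAt.eventually_ne (g := fun s => α + s * β) (by fun_prop) ?_)
    simpa using hα

/-- The common limit is evaluated along one convenient path, with `b = a` fixed and `σ` varying,
where the residue theorem in the unit disc applies. -/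
theorem tendsto_sum_residue {τ : ℂ} (hτ : τ.re < 0) (hne : ∃ p, 0 < a p) {β : Type} {l : Filter β}
    {q : β → (ι → ℂ) × (ι → ℂ)} (hq : Tendsto q l (𝓝 (fun _ => τ, fun p => (a p : ℂ))))
    (hinj : ∀ᶠ x in l, ∀ m > 0, Set.InjOn (pole (q x)) {p | a p = m}) :
    Tendsto (fun x => ∑ P with 0 < a P, ∑ ζ ∈ unityRoots (a P), residue ζ a (q x) P) l
      (𝓝 ((2 * Real.pi * Complex.I)⁻¹ *
        ∮ z in C(0, 1), residueIntegrand a (fun _ => Complex.exp τ) z)) := by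
  obtain ⟨L, hL⟩ := exists_tendsto_sum_residue a hτ
  let v : ι → ℝ := fun p => (Fintype.equivFin ι p : ℕ)
  have hv : ∀ p p', v p - v p' = 0 → p = p' := by
    intro p p' h
    have h' : v p = v p' := sub_eq_zero.mp h
    simpa [v, Fin.val_inj] using h'
  -- The factor `a p` makes the poles move as `τ / a_p + s v_p`. As the `v_p` are distinct reals,
  -- for small `s ≠ 0` poles with different indices have different moduli in the disc.
  let σ : ℝ → ι → ℂ := fun s p => τ + (s : ℂ) * (a p * v p)
  have hσ0 : Tendsto σ (𝓝[≠] 0) (𝓝 fun _ => τ) := by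
    have h : ContinuousAt σ 0 := by fun_prop
    have h0 : σ 0 = fun _ => τ := by
      ext p
      simp [σ]
    rw [ContinuousAt, h0] at h
    exact h.mono_left nhdsWithin_le_nhds
  have hpole : ∀ s p, a p ≠ 0 → σ s p / a p = τ / a p + s * v p := by
    intro s p hp
    have : (a p : ℂ) ≠ 0 := by exact_mod_cast hp
    simp only [σ]
    field_simp
  have hre : ∀ s p, 0 < a p → (σ s p).re / a p = τ.re / a p + s * v p := by
    intro s p hp
    rw [← Complex.div_intCast_re, hpole s p hp.ne', Complex.add_re, Complex.div_intCast_re,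
      ← Complex.ofReal_mul, Complex.ofReal_re]
  have hneg : ∀ᶠ s in 𝓝[≠] (0 : ℝ), ∀ p, (σ s p).re < 0 := by
    rw [eventually_all]
    intro p
    have h1 : Tendsto (fun s => (σ s p).re) (𝓝[≠] 0) (𝓝 τ.re) :=
      (Complex.continuous_re.tendsto _).comp ((tendsto_pi_nhds.mp hσ0) p)
    exact h1.eventually_lt_const hτ
  have hdisc : ∀ᶠ s in 𝓝[≠] (0 : ℝ), Set.InjOn (discPole a (σ s))
      (({p | 0 < a p} : Finset ι).sigma fun p => unityRoots (a p)) := by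
    have h1 : ∀ᶠ s in 𝓝[≠] (0 : ℝ), ∀ p p', p ≠ p' →
        (τ.re / a p - τ.re / a p') + s * (v p - v p') ≠ 0 := by
      rw [eventually_all]
      intro p
      rw [eventually_all]
      intro p'
      by_cases hp : p = p'
      · simp [hp]
      · filter_upwards [eventually_add_mul_ne_zero (τ.re / a p - τ.re / a p')
          (fun h => hp (hv p p' h))] with s hs _ using hs
    filter_upwards [h1] with s hs
    rintro ⟨p, ζ⟩ hx ⟨p', ζ'⟩ hx' h
    simp only [Finset.coe_sigma, Set.mem_sigma_iff, Finset.mem_coe, Finset.mem_filter,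
      Finset.mem_univ, true_and] at hx hx'
    have hpp : p = p' := by
      by_contra hp
      have h2 := congrArg norm h
      rw [norm_discPole a _ hx.1 hx.2, norm_discPole a _ hx'.1 hx'.2, Real.exp_eq_exp,
        hre s p hx.1, hre s p' hx'.1] at h2
      exact hs p p' hp (by linear_combination h2)
    subst hpp
    simp only [discPole] at h
    rw [mul_right_cancel₀ (Complex.exp_ne_zero _) h]
  have hlim1 : Tendsto (fun s => (2 * Real.pi * Complex.I : ℂ)⁻¹ *
      ∮ z in C(0, 1), residueIntegrand a (fun p => Complex.exp (σ s p)) z) (𝓝[≠] 0)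
      (𝓝 ((2 * Real.pi * Complex.I)⁻¹ *
        ∮ z in C(0, 1), residueIntegrand a (fun _ => Complex.exp τ) z)) :=
    ((continuousAt_circleIntegral_residueIntegrand a (σ := fun _ => τ)
      (fun _ => hτ)).tendsto.comp hσ0).const_mul _
  have hlim2 := hL (𝓝[≠] (0 : ℝ)) (fun s => (σ s, fun p => (a p : ℂ)))
    (hσ0.prodMk_nhds tendsto_const_nhds) (by
      filter_upwards [self_mem_nhdsWithin] with s hs m hm p hp p' hp' h
      simp only [Set.mem_ofPred_eq] at hp hp'
      simp only [pole] at h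
      rw [hpole s p (by omega), hpole s p' (by omega), hp, hp', add_right_inj] at h
      have hs' : (s : ℂ) ≠ 0 := by exact_mod_cast hs
      have h1 : (v p : ℂ) = v p' := mul_left_cancel₀ hs' h
      exact hv p p' (sub_eq_zero.mpr (by exact_mod_cast h1)))
  have hlim3 : Tendsto (fun s => (2 * Real.pi * Complex.I : ℂ)⁻¹ *
      ∮ z in C(0, 1), residueIntegrand a (fun p => Complex.exp (σ s p)) z) (𝓝[≠] 0) (𝓝 L) := by
    refine hlim2.congr' ?_
    filter_upwards [hneg, hdisc] with s h1 h2
    rw [circleIntegral_residueIntegrand a h1 hne h2, inv_mul_cancel_left₀ Complex.two_pi_I_ne_zero]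
  rw [tendsto_nhds_unique hlim1 hlim3]
  exact hL l q hq hinj

end Global

/-! ### The sum indexed by all weights -/

section ThetaSum

variable {r : ℕ} (d : Fin r → ℕ)

/-- Otherwise the first summand is `V_0`, whose constant form `1` is a nonzero invariant vector. -/
theorem exists_weight_pos (hr : 0 < r)
    (hV : ∀ v, (∀ g : SL2, rep d g v = v) → v = 0) : ∃ p, 0 < weight d p := by
  by_contra! h
  have h0 : d ⟨0, hr⟩ = 0 := by
    have := h ⟨⟨0, hr⟩, Fin.last _⟩
    simp only [weight, Fin.val_last] at this
    omega
  have h1 : (1 : MvPolynomial (Fin 2) ℂ) ∈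
      MvPolynomial.homogeneousSubmodule (Fin 2) ℂ (d ⟨0, hr⟩) := by
    rw [h0]
    exact MvPolynomial.isHomogeneous_one _ _
  have h2 := hV (DirectSum.lof ℂ (Fin r) (fun k => BinaryForm (d k)) ⟨0, hr⟩ ⟨1, h1⟩) fun g => by
    have h3 : binaryRep (d ⟨0, hr⟩) g ⟨1, h1⟩ = ⟨1, h1⟩ := Subtype.ext (map_one (subst g))
    change DirectSum.lmap (fun k => binaryRep (d k) g) _ = _
    rw [DirectSum.lmap_lof, h3]
  have h4 := congrArg (fun v => ((v ⟨0, hr⟩ : BinaryForm (d ⟨0, hr⟩)) : MvPolynomial (Fin 2) ℂ)) h2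
  simp only [DirectSum.lof_apply] at h4
  exact one_ne_zero h4

/-- The parameters `(σ, b)` with constant `σ`. -/
def constParam {ι : Type*} (τ : ℂ) (b : ι → ℝ) : (ι → ℂ) × (ι → ℂ) :=
  (fun _ => τ, fun p => (b p : ℂ))

theorem continuous_constParam {ι : Type*} (τ : ℂ) :
    Continuous (constParam τ : (ι → ℝ) → (ι → ℂ) × (ι → ℂ)) := by
  unfold constParam
  fun_prop

theorem constParam_aTheta (τ : ℂ) :
    constParam τ (aTheta d) = (fun _ => τ, fun p => (weight d p : ℂ)) := by
  simp [constParam, aTheta]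

theorem termTheta_eq_residue (τ : ℂ) (b : Theta d → ℝ) (P : Lam d) (ζ : ℂ) :
    termTheta d τ b P ζ = residue ζ (weight d) (constParam τ b) P.1 := by
  by_cases hP : b P.1 = 0
  -- Both sides are quotients by zero, hence `0` by convention.
  · simp [termTheta, denTheta, residue, constParam, hP]
  have hP' : (b P.1 : ℂ) ≠ 0 := by exact_mod_cast hP
  have h1 : bpow τ (2 / b P.1) = Complex.exp (2 * pole (constParam τ b) P.1) := by
    rw [bpow, pole, constParam]
    push_cast
    ring_nf
  have h2 : ∀ p, 1 - ζ ^ (-weight d p) * bpow τ ((b P.1 - b p) / b P.1) =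
      expFactor ζ (weight d) (constParam τ b) p (pole (constParam τ b) P.1) := by
    intro p
    rw [expFactor, bpow, pole, constParam]
    push_cast
    congr 3
    field_simp
  rw [termTheta, denTheta, residue, h1, Finset.prod_congr rfl fun p _ => h2 p]
  rfl

theorem sum_lam_filter (m : ℤ) (hm : 0 < m) (f : Theta d → ℂ) :
    ∑ P : Lam d with weight d P.1 = m, f P.1 = ∑ p with weight d p = m, f p := by
  refine Finset.sum_bij (fun P _ => P.1) (fun P hP => by simpa using hP)
    (fun P _ Q _ h => Subtype.ext h) (fun p hp => ?_) (fun _ _ => rfl)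
  have hp' := (Finset.mem_filter.mp hp).2
  exact ⟨⟨p, hp' ▸ hm⟩, by simpa using hp', rfl⟩

theorem partTheta_eq (τ : ℂ) {m : ℤ} (hm : 0 < m) (ζ : ℂ) (b : Theta d → ℝ) :
    partTheta d τ m ζ b =
      ∑ p with weight d p = m, residue ζ (weight d) (constParam τ b) p := by
  rw [partTheta, ← sum_lam_filter d m hm]
  exact Finset.sum_congr rfl fun P _ => termTheta_eq_residue d τ b P ζ

theorem sumTheta_eq (τ : ℂ) (b : Theta d → ℝ) :
    sumTheta d τ b = ∑ p with 0 < weight d p, ∑ ζ ∈ unityRoots (weight d p),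
      residue ζ (weight d) (constParam τ b) p := by
  rw [sumTheta, Finset.sum_congr rfl fun P _ =>
    Finset.sum_congr rfl fun ζ _ => termTheta_eq_residue d τ b P ζ]
  exact (Finset.sum_subtype (p := fun p => 0 < weight d p) _ (fun p => by simp)
    (fun p => ∑ ζ ∈ unityRoots (weight d p), residue ζ (weight d) (constParam τ b) p)).symm

/-- If `b_P = b_p` with `p ≠ P`, the summand with `ζ = 1` has a vanishing factor in its denominator.
-/
theorem injOn_pole_of_mem_domTheta {τ : ℂ} (hτ : τ ≠ 0) {b : Theta d → ℝ}
    (hb : b ∈ domTheta d τ) {m : ℤ} (hm : 0 < m) :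
    Set.InjOn (pole (constParam τ b)) {p | weight d p = m} := by
  intro P hP p _ h
  by_contra hne
  simp only [Set.mem_ofPred_eq] at hP
  have hden := hb ⟨P, hP ▸ hm⟩ 1 ((mem_unityRoots (hP ▸ hm)).mpr (one_zpow _))
  have h1 : b P = b p := by
    simp only [pole, constParam, div_eq_mul_inv] at h
    exact_mod_cast inv_injective (mul_left_cancel₀ hτ h)
  refine hden (mul_eq_zero_of_right _ (Finset.prod_eq_zero
    (Finset.mem_erase.mpr ⟨Ne.symm hne, Finset.mem_univ p⟩) ?_))
  simp [h1, bpow]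

/-- The subtracted term has modulus `exp (((b_P - b_p) / b_P) Re τ)`, which differs from `1`. Hence
the domain contains the complement of finitely many hyperplanes, and density follows by moving along
a generic line. -/
theorem mem_domTheta_of_ne {τ : ℂ} (hτ : τ.re < 0) {b : Theta d → ℝ}
    (h0 : ∀ P, 0 < weight d P → b P ≠ 0) (h1 : ∀ P p, 0 < weight d P → p ≠ P → b P ≠ b p) :
    b ∈ domTheta d τ := by
  intro P ζ hζ
  refine mul_ne_zero (by exact_mod_cast h0 P P.2) (Finset.prod_ne_zero_iff.mpr fun p hp => ?_)
  intro h
  have h2 := congrArg norm (sub_eq_zero.mp h)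
  rw [norm_one, norm_mul, norm_zpow, norm_eq_one_of_mem_unityRoots P.2 hζ, one_zpow, one_mul, bpow,
    Complex.norm_exp, Complex.re_ofReal_mul, eq_comm, Real.exp_eq_one_iff] at h2
  have h3 := (mul_eq_zero.mp h2).resolve_right hτ.ne
  rcases div_eq_zero_iff.mp h3 with h4 | h4
  · exact h1 P p P.2 (Finset.ne_of_mem_erase hp) (sub_eq_zero.mp h4)
  · exact h0 P P.2 h4

theorem eventually_add_smul_mem_domTheta {τ : ℂ} (hτ : τ.re < 0) (b : Theta d → ℝ)
    {v : Theta d → ℝ} (h0 : ∀ P, 0 < weight d P → v P ≠ 0)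
    (h1 : ∀ P p, 0 < weight d P → p ≠ P → v P ≠ v p) :
    ∀ᶠ s in 𝓝[≠] (0 : ℝ), b + s • v ∈ domTheta d τ := by
  have e0 : ∀ᶠ s in 𝓝[≠] (0 : ℝ), ∀ P, 0 < weight d P → b P + s * v P ≠ 0 := by
    rw [eventually_all]
    intro P
    by_cases hP : 0 < weight d P
    · exact (eventually_add_mul_ne_zero (b P) (h0 P hP)).mono fun _ h _ => h
    · exact Eventually.of_forall fun _ h => (hP h).elim
  have e1 : ∀ᶠ s in 𝓝[≠] (0 : ℝ), ∀ P p, 0 < weight d P → p ≠ P →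
      (b P - b p) + s * (v P - v p) ≠ 0 := by
    rw [eventually_all]
    intro P
    rw [eventually_all]
    intro p
    by_cases hP : 0 < weight d P ∧ p ≠ P
    · exact (eventually_add_mul_ne_zero (b P - b p)
        (sub_ne_zero.mpr (h1 P p hP.1 hP.2))).mono fun _ h _ _ => h
    · exact Eventually.of_forall fun _ h h' => (hP ⟨h, h'⟩).elim
  filter_upwards [e0, e1] with s hs0 hs1
  refine mem_domTheta_of_ne d hτ hs0 fun P p hP hp h => hs1 P p hP hp ?_
  simp only [Pi.add_apply, Pi.smul_apply, smul_eq_mul] at h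
  linear_combination h

theorem mem_closure_of_eventually_add_smul {ι : Type*} {S : Set (ι → ℝ)} {b v : ι → ℝ}
    (h : ∀ᶠ s in 𝓝[≠] (0 : ℝ), b + s • v ∈ S) : b ∈ closure S := by
  have hc : ContinuousAt (fun s : ℝ => b + s • v) 0 := by fun_prop
  have ht : Tendsto (fun s : ℝ => b + s • v) (𝓝[≠] 0) (𝓝 b) := by
    have := hc.tendsto.mono_left (nhdsWithin_le_nhds (s := {0}ᶜ))
    simpa using this
  exact mem_closure_of_tendsto ht h

theorem mem_closure_domTheta {τ : ℂ} (hτ : τ.re < 0) (b : Theta d → ℝ) :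
    b ∈ closure (domTheta d τ) := by
  refine mem_closure_of_eventually_add_smul (v := fun p => (Fintype.equivFin _ p : ℕ) + 1)
    (eventually_add_smul_mem_domTheta d hτ b (fun P _ => by positivity) fun P p _ hp h => hp ?_)
  simpa [Fin.val_inj] using h.symm

theorem tendsto_sumTheta {τ : ℂ} (hτ : τ.re < 0) (hne : ∃ p, 0 < weight d p) :
    Tendsto (sumTheta d τ) (𝓝[domTheta d τ] (aTheta d))
      (𝓝 (hilb (rep d) (Complex.exp τ))) := by
  have ht : ‖Complex.exp τ‖ < 1 := by
    rw [Complex.norm_exp]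
    exact Real.exp_lt_one_iff.mpr hτ
  have hτ0 : τ ≠ 0 := by
    rintro rfl
    simp at hτ
  have hq : Tendsto (constParam τ) (𝓝[domTheta d τ] (aTheta d))
      (𝓝 (fun _ => τ, fun p => (weight d p : ℂ))) := by
    rw [← constParam_aTheta]
    exact (continuous_constParam τ).continuousAt.mono_left nhdsWithin_le_nhds
  have h := tendsto_sum_residue (weight d) hτ hne hq (by
    filter_upwards [self_mem_nhdsWithin] with b hb m hm
    exact injOn_pole_of_mem_domTheta d hτ0 hb hm)
  have h1 := circleIntegral_weylIntegrand d ht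
  simp only [weylIntegrand] at h1
  simp only [residueIntegrand] at h
  rw [h1, inv_mul_cancel_left₀ Complex.two_pi_I_ne_zero] at h
  exact h.congr fun b => (sumTheta_eq d τ b).symm

theorem exists_continuous_partTheta {τ : ℂ} (hτ : τ.re < 0) {m : ℤ} (hm : 0 < m) {ζ : ℂ}
    (hζ : ζ ^ m = 1) : ∃ F : (Theta d → ℝ) → ℂ, (∀ᶠ b in 𝓝 (aTheta d), ContinuousAt F b) ∧
      ∀ᶠ b in 𝓝 (aTheta d), b ∈ domTheta d τ → F b = partTheta d τ m ζ b := by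
  have hτ0 : τ ≠ 0 := by
    rintro rfl
    simp at hτ
  obtain ⟨C, h1, h2⟩ := exists_continuous_sum_residue (a := weight d) hm hζ hτ
  rw [← constParam_aTheta] at h1 h2
  have hc := (continuous_constParam (ι := Theta d) τ)
  refine ⟨fun b => C (constParam τ b), ?_, ?_⟩
  · filter_upwards [hc.continuousAt.eventually h1] with b hb
    exact hb.comp hc.continuousAt
  · filter_upwards [hc.continuousAt.eventually h2] with b hb hdom
    rw [partTheta_eq d τ hm]
    exact hb (injOn_pole_of_mem_domTheta d hτ0 hdom hm)

end ThetaSum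

/-! ### Reduction of the sum indexed by the positive weights -/

section LambdaSum

variable {r : ℕ} (d : Fin r → ℕ)

/-- The involution `(k, i) ↦ (k, d_k - i)`. -/
def revIdx (p : Theta d) : Theta d := ⟨p.1, Fin.rev p.2⟩

theorem revIdx_revIdx (p : Theta d) : revIdx d (revIdx d p) = p := by
  simp [revIdx]

theorem weight_revIdx (p : Theta d) : weight d (revIdx d p) = -weight d p := by
  have := p.2.2
  simp only [weight, revIdx, Fin.val_rev]
  omega

/-- The extension of parameters indexed by `Λ` to parameters indexed by `Θ` which is odd under
`(k, i) ↦ (k, d_k - i)`. -/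
noncomputable def oddExt (b : Lam d → ℝ) (p : Theta d) : ℝ :=
  if h : 0 < weight d p then b ⟨p, h⟩
  else if h : 0 < weight d (revIdx d p) then -b ⟨revIdx d p, h⟩ else 0

variable {d}

theorem oddExt_of_pos (b : Lam d → ℝ) (P : Lam d) : oddExt d b P.1 = b P := by
  rw [oddExt, dif_pos P.2]

theorem oddExt_revIdx (b : Lam d → ℝ) (P : Lam d) : oddExt d b (revIdx d P.1) = -b P := by
  have h1 := weight_revIdx d P.1
  have h2 := P.2
  have h3 : 0 < weight d (revIdx d (revIdx d P.1)) := by rwa [revIdx_revIdx]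
  rw [oddExt, dif_neg (by omega), dif_pos h3]
  congr 2
  exact Subtype.ext (revIdx_revIdx d P.1)

theorem oddExt_of_eq_zero (b : Lam d → ℝ) {p : Theta d} (hp : weight d p = 0) :
    oddExt d b p = 0 := by
  have h1 := weight_revIdx d p
  rw [oddExt, dif_neg (by omega), dif_neg (by omega)]

theorem theta_cases (p : Theta d) :
    (∃ P : Lam d, p = P.1) ∨ (∃ P : Lam d, p = revIdx d P.1) ∨ weight d p = 0 := by
  rcases lt_trichotomy (weight d p) 0 with h | h | h
  · refine Or.inr (Or.inl ⟨⟨revIdx d p, ?_⟩, (revIdx_revIdx d p).symm⟩)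
    rw [weight_revIdx]
    omega
  · exact Or.inr (Or.inr h)
  · exact Or.inl ⟨⟨p, h⟩, rfl⟩

theorem oddExt_add_smul (b v : Lam d → ℝ) (s : ℝ) :
    oddExt d (b + s • v) = oddExt d b + s • oddExt d v := by
  ext p
  simp only [Pi.add_apply, Pi.smul_apply, smul_eq_mul]
  rcases theta_cases p with ⟨P, rfl⟩ | ⟨P, rfl⟩ | h
  · simp [oddExt_of_pos]
  · simp only [oddExt_revIdx, Pi.add_apply, Pi.smul_apply, smul_eq_mul]
    ring
  · simp [oddExt_of_eq_zero _ h]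

theorem oddExt_aLam : oddExt d (aLam d) = aTheta d := by
  ext p
  rcases theta_cases p with ⟨P, rfl⟩ | ⟨P, rfl⟩ | h
  · rw [oddExt_of_pos]
    rfl
  · rw [oddExt_revIdx, aTheta, weight_revIdx, Int.cast_neg]
    rfl
  · rw [oddExt_of_eq_zero _ h, aTheta, h, Int.cast_zero]

theorem continuous_oddExt : Continuous (oddExt d) := by
  refine continuous_pi fun p => ?_
  rcases theta_cases p with ⟨P, rfl⟩ | ⟨P, rfl⟩ | h
  · simp only [oddExt_of_pos]
    fun_prop
  · simp only [oddExt_revIdx]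
    fun_prop
  · simp only [oddExt_of_eq_zero _ h]
    fun_prop

variable (d) in
theorem card_weight_eq_zero :
    (Finset.univ.filter fun p : Theta d => weight d p = 0).card = numEven d := by
  refine Finset.card_bij (fun p _ => p.1) ?_ ?_ ?_
  · intro p hp
    have h := (Finset.mem_filter.mp hp).2
    simp only [weight] at h
    simp only [Finset.mem_filter, Finset.mem_univ, true_and]
    exact ⟨(p.2 : ℕ), by omega⟩
  · rintro ⟨k, i⟩ hp ⟨k', i'⟩ hp' h
    have h1 := (Finset.mem_filter.mp hp).2
    have h2 := (Finset.mem_filter.mp hp').2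
    simp only at h
    subst h
    simp only [weight] at h1 h2
    have h3 : i = i' := Fin.ext (by omega)
    rw [h3]
  · intro k hk
    obtain ⟨j, hj⟩ := (Finset.mem_filter.mp hk).2
    refine ⟨⟨k, ⟨j, by omega⟩⟩, Finset.mem_filter.mpr ⟨Finset.mem_univ _, ?_⟩, rfl⟩
    simp only [weight]
    omega

/-- `Θ` splits by the sign of the weight, and the reversal identifies the negative part with `Λ`. -/
theorem prod_theta_erase (P : Lam d) (f : Theta d → ℂ) :
    ∏ p ∈ Finset.univ.erase P.1, f p =
      (∏ p ∈ Finset.univ.erase P, f p.1) * (∏ p : Lam d, f (revIdx d p.1)) *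
        ∏ p with weight d p = 0, f p := by
  have h1 : (Finset.univ.erase P.1).filter (fun p => 0 < weight d p) =
      (Finset.univ.erase P).map (Function.Embedding.subtype _) := by
    ext p
    simp only [Finset.mem_filter, Finset.mem_erase, Finset.mem_univ, and_true, Finset.mem_map,
      Function.Embedding.subtype_apply]
    constructor
    · rintro ⟨h, h'⟩
      exact ⟨⟨p, h'⟩, fun e => h (congrArg Subtype.val e), rfl⟩
    · rintro ⟨Q, hQ, rfl⟩
      exact ⟨fun e => hQ (Subtype.ext e), Q.2⟩
  have hP := P.2
  have h2 : ((Finset.univ.erase P.1).filter (fun p => ¬ 0 < weight d p)).filter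
      (fun p => weight d p = 0) = Finset.univ.filter fun p => weight d p = 0 := by
    ext p
    simp only [Finset.mem_filter, Finset.mem_erase, Finset.mem_univ, and_true, true_and]
    constructor
    · exact fun h => h.2
    · intro h
      refine ⟨⟨?_, by omega⟩, h⟩
      rintro rfl
      omega
  have h3 : ((Finset.univ.erase P.1).filter (fun p => ¬ 0 < weight d p)).filter
      (fun p => ¬ weight d p = 0) = Finset.univ.filter fun p => weight d p < 0 := by
    ext p
    simp only [Finset.mem_filter, Finset.mem_erase, Finset.mem_univ, and_true, true_and]
    constructor
    · rintro ⟨⟨_, h⟩, h'⟩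
      omega
    · intro h
      refine ⟨⟨?_, by omega⟩, by omega⟩
      rintro rfl
      omega
  have h4 : ∏ p with weight d p < 0, f p = ∏ p : Lam d, f (revIdx d p.1) := by
    symm
    refine Finset.prod_bij (fun p _ => revIdx d p.1) ?_ ?_ ?_ (fun _ _ => rfl)
    · intro p _
      have := p.2
      simp only [Finset.mem_filter, Finset.mem_univ, true_and, weight_revIdx]
      omega
    · intro p _ q _ h
      have := congrArg (revIdx d) h
      rw [revIdx_revIdx, revIdx_revIdx] at this
      exact Subtype.ext this
    · intro p hp
      have := (Finset.mem_filter.mp hp).2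
      exact ⟨⟨revIdx d p, by rw [weight_revIdx]; omega⟩, Finset.mem_univ _, revIdx_revIdx d p⟩
  rw [← Finset.prod_filter_mul_prod_filter_not (Finset.univ.erase P.1) (fun p => 0 < weight d p),
    h1, Finset.prod_map, ← Finset.prod_filter_mul_prod_filter_not
      ((Finset.univ.erase P.1).filter (fun p => ¬ 0 < weight d p)) (fun p => weight d p = 0),
    h2, h3, h4]
  simp only [Function.Embedding.subtype_apply]
  ring

/-- At odd parameters the zero weights give `(1 - t)^e`, the weight opposite to `P` gives `1 - t²`
because `ζ ^ a_P = 1`, and every other opposite pair gives a factor `β`. -/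
theorem denLam_eq_denTheta {t τ : ℂ} (hτ : Complex.exp τ = t) (b : Lam d → ℝ) (P : Lam d) {ζ : ℂ}
    (hζ : ζ ^ weight d P.1 = 1) :
    denLam d t τ b P ζ = denTheta d τ (oddExt d b) P ζ := by
  rw [denLam, denTheta, oddExt_of_pos]
  by_cases hP : b P = 0
  · simp [hP]
  have hzero : ∏ p with weight d p = 0,
      (1 - ζ ^ (-weight d p) * bpow τ ((b P - oddExt d b p) / b P)) = (1 - t) ^ numEven d := by
    rw [← card_weight_eq_zero, ← Finset.prod_const]
    refine Finset.prod_congr rfl fun p hp => ?_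
    have hp0 := (Finset.mem_filter.mp hp).2
    rw [hp0, oddExt_of_eq_zero b hp0, sub_zero, div_self hP, bpow, Complex.ofReal_one, one_mul, hτ,
      neg_zero, zpow_zero, one_mul]
  have hself : 1 - ζ ^ (-weight d (revIdx d P.1)) *
      bpow τ ((b P - oddExt d b (revIdx d P.1)) / b P) = 1 - t ^ 2 := by
    rw [weight_revIdx, neg_neg, hζ, oddExt_revIdx, sub_neg_eq_add, add_div, div_self hP, bpow,
      ← hτ, ← Complex.exp_nat_mul, one_mul]
    congr 3
    norm_num
  rw [prod_theta_erase, hzero, ← Finset.mul_prod_erase Finset.univ _ (Finset.mem_univ P), hself]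
  have hbeta : ∏ p ∈ Finset.univ.erase P, beta d τ b P p ζ =
      (∏ p ∈ Finset.univ.erase P,
        (1 - ζ ^ (-weight d p.1) * bpow τ ((b P - oddExt d b p.1) / b P))) *
      ∏ p ∈ Finset.univ.erase P, (1 - ζ ^ (-weight d (revIdx d p.1)) *
        bpow τ ((b P - oddExt d b (revIdx d p.1)) / b P)) := by
    rw [← Finset.prod_mul_distrib]
    refine Finset.prod_congr rfl fun p _ => ?_
    rw [beta, oddExt_of_pos, oddExt_revIdx, weight_revIdx, neg_neg, sub_neg_eq_add]
  rw [hbeta]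
  ring

theorem termLam_eq_termTheta {t τ : ℂ} (hτ : Complex.exp τ = t) (b : Lam d → ℝ) (P : Lam d)
    {ζ : ℂ} (hζ : ζ ^ weight d P.1 = 1) :
    termLam d t τ b P ζ = termTheta d τ (oddExt d b) P ζ := by
  rw [termLam, termTheta, denLam_eq_denTheta hτ b P hζ, oddExt_of_pos]

theorem mem_domLam_iff {t τ : ℂ} (hτ : Complex.exp τ = t) (b : Lam d → ℝ) :
    b ∈ domLam d t τ ↔ oddExt d b ∈ domTheta d τ := by
  refine forall_congr' fun P => forall₂_congr fun ζ hζ => ?_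
  rw [denLam_eq_denTheta hτ b P ((mem_unityRoots P.2).mp hζ)]

theorem sumLam_eq_sumTheta {t τ : ℂ} (hτ : Complex.exp τ = t) (b : Lam d → ℝ) :
    sumLam d t τ b = sumTheta d τ (oddExt d b) :=
  Finset.sum_congr rfl fun P _ => Finset.sum_congr rfl fun _ hζ =>
    termLam_eq_termTheta hτ b P ((mem_unityRoots P.2).mp hζ)

theorem partLam_eq_partTheta {t τ : ℂ} (hτ : Complex.exp τ = t) {m : ℤ} {ζ : ℂ} (hζ : ζ ^ m = 1)
    (b : Lam d → ℝ) : partLam d t τ m ζ b = partTheta d τ m ζ (oddExt d b) := by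
  refine Finset.sum_congr rfl fun P hP => termLam_eq_termTheta hτ b P ?_
  rw [(Finset.mem_filter.mp hP).2, hζ]

theorem mem_closure_domLam {t τ : ℂ} (hτ : Complex.exp τ = t) (hre : τ.re < 0) (b : Lam d → ℝ) :
    b ∈ closure (domLam d t τ) := by
  -- Positivity matters as well as distinctness: it separates these entries from the negated and
  -- zero entries of the odd extension.
  let v : Lam d → ℝ := fun p => (Fintype.equivFin _ p : ℕ) + 1
  have hv : ∀ p, 0 < v p := fun p => by positivity
  refine mem_closure_of_eventually_add_smul (v := v) ?_
  simp only [mem_domLam_iff hτ, oddExt_add_smul]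
  refine eventually_add_smul_mem_domTheta d hre _ (fun P hP => ?_) fun P p hP hp => ?_
  · rw [oddExt_of_pos v ⟨P, hP⟩]
    exact (hv _).ne'
  · rw [oddExt_of_pos v ⟨P, hP⟩]
    rcases theta_cases p with ⟨Q, rfl⟩ | ⟨Q, rfl⟩ | h
    · rw [oddExt_of_pos]
      intro h
      have h' : Q = ⟨P, hP⟩ := by simpa [v, Fin.val_inj] using h.symm
      exact hp (congrArg Subtype.val h')
    · rw [oddExt_revIdx]
      have := hv Q
      have := hv ⟨P, hP⟩
      exact ne_of_gt (by linarith)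
    · rw [oddExt_of_eq_zero _ h]
      exact (hv _).ne'

end LambdaSum

end SL2Hilb

/-! ### The limit formulas and removable singularities -/

theorem theorem3p2 {r : ℕ} (hr : 0 < r) (d : Fin r → ℕ)
    (hV : ∀ v, (∀ g : SL2Hilb.SL2, SL2Hilb.rep d g v = v) → v = 0)
    (t τ : ℂ) (ht : ‖t‖ < 1) (hτ : Complex.exp τ = t) :
    Summable (SL2Hilb.hilbTerm (SL2Hilb.rep d) t) ∧
    SL2Hilb.HasLimitOn (SL2Hilb.sumLam d t τ) (SL2Hilb.domLam d t τ) (SL2Hilb.aLam d)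
      (SL2Hilb.hilb (SL2Hilb.rep d) t) ∧
    SL2Hilb.HasLimitOn (SL2Hilb.sumTheta d τ) (SL2Hilb.domTheta d τ) (SL2Hilb.aTheta d)
      (SL2Hilb.hilb (SL2Hilb.rep d) t) ∧
    (∀ m : ℤ, 0 < m → ∀ ζ : ℂ, ζ ^ m = 1 →
      SL2Hilb.HasRemovableSingularities (SL2Hilb.partLam d t τ m ζ) (SL2Hilb.domLam d t τ)
        (SL2Hilb.aLam d) ∧
      SL2Hilb.HasRemovableSingularities (SL2Hilb.partTheta d τ m ζ) (SL2Hilb.domTheta d τ)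
        (SL2Hilb.aTheta d)) := by
  open SL2Hilb in
  have hre : τ.re < 0 := by
    rw [← hτ, Complex.norm_exp] at ht
    exact Real.exp_lt_one_iff.mp ht
  have hlim := tendsto_sumTheta d hre (exists_weight_pos d hr hV)
  rw [hτ] at hlim
  have hext : Tendsto (oddExt d) (𝓝 (aLam d)) (𝓝 (aTheta d)) := by
    rw [← oddExt_aLam]
    exact continuous_oddExt.continuousAt
  refine ⟨summable_hilbTerm d ht, ⟨mem_closure_domLam hτ hre _, ?_⟩,
    ⟨mem_closure_domTheta d hre _, hlim⟩, fun m hm ζ hζ => ?_⟩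
  -- The statements for `Λ` are pulled back from those for `Θ` along the continuous map `oddExt`,
  -- which respects the domains.
  · have h : Tendsto (oddExt d) (𝓝[domLam d t τ] (aLam d)) (𝓝[domTheta d τ] (aTheta d)) :=
      tendsto_nhdsWithin_of_tendsto_nhds_of_eventually_within _
        (hext.mono_left nhdsWithin_le_nhds) (by
          filter_upwards [self_mem_nhdsWithin] with b hb
          exact (mem_domLam_iff hτ b).mp hb)
    exact (hlim.comp h).congr fun b => (sumLam_eq_sumTheta hτ b).symm
  · obtain ⟨F, hF1, hF2⟩ := exists_continuous_partTheta d hre hm hζ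
    refine ⟨⟨Eventually.of_forall fun b => mem_closure_domLam hτ hre b, fun b => F (oddExt d b),
      ?_, ?_⟩, ⟨Eventually.of_forall fun b => mem_closure_domTheta d hre b, F, hF1, hF2⟩⟩
    · filter_upwards [hext.eventually hF1] with b hb
      exact hb.comp continuous_oddExt.continuousAt
    · filter_upwards [hext.eventually hF2] with b hb hdom
      rw [partLam_eq_partTheta hτ hζ]
      exact hb ((mem_domLam_iff hτ b).mp hdom)
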